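/- For an even integer $k\ge 4$ let $E_k(z)=\frac12\sum_{(c,d)=1}(cz+d)^{-k}$ (sum over coprime pairs of integers) be the normalised Eisenstein series of weight $k$ for $\mathrm{SL}_2(\mathbb{Z})$. For even $k,\ell\ge 4$ put $\Delta_{k,\ell}=E_kE_\ell-E_{k+\ell}$, and let $B_{k,\ell}$ be the number of distinct zeros $z=x+iy$ of $\Delta_{k,\ell}$ with $x=\frac12$ and $y>\frac{\sqrt3}{2}$. For an even integer $\ell$ and $0\le j<12$ define $\mathrm{sp}_j(\ell)=\ell$, except that $$\mathrm{sp}_j(\ell)=\begin{cases}\frac{\ell-1+\sqrt{3\ell^2-1}}{2} & \text{if }\ell\equiv 0,\ j\equiv 2 \pmod 6,\\ 2\ell & \text{if }\ell\equiv 4,\ j\equiv 2\pmod 6,\\ \frac{4\ell-1+\sqrt{12\ell^2-12\ell+1}}{2} & \text{if }\ell\equiv 4,\ j\equiv 0\pmod 6.\end{cases}$$ Theorem. There is an absolute constant $L$ such that the following holds for all even integers $k\ge\ell\ge L$ (with $k,\ell\ge 4$). Write $k-\ell=12n+j$ with integers $n\ge 0$ and $0\le j<12$. If $k\ge \mathrm{sp}_j(\ell)$,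 and moreover $k\neq \mathrm{sp}_j(\ell)$ in the case $\ell\equiv 4$, $j\equiv 0\pmod 6$, then $B_{k,\ell}$ is finite and $$B_{k,\ell}\ \ge\ T'_{k,\ell}:=\begin{cases}\lfloor \ell/6\rfloor-1 & \text{if }\ell\equiv 0,2\pmod 6,\\ \lfloor \ell/6\rfloor & \text{if }\ell\equiv 4\pmod 6.\end{cases}$$ -/

import Mathlib

open scoped UpperHalfPlane

noncomputable section

/-- The form `Δ_{k,ℓ} = E_k E_ℓ - E_{k+ℓ}` of weight `k + ℓ`, as a function on the upper half-plane.
Here `ModularForm.E` is the Eisenstein series `½ ∑_{(c,d)=1} (cz+d)^{-k}`, see `eisenstein_apply`. -/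
def eisensteinDelta {k ℓ : ℕ} (hk : 4 ≤ k) (hℓ : 4 ≤ ℓ) (z : ℍ) : ℂ :=
  ModularForm.E (show 3 ≤ k by omega) z * ModularForm.E (show 3 ≤ ℓ by omega) z
    - ModularForm.E (show 3 ≤ k + ℓ by omega) z

/-- The normalisation of `ModularForm.E`: half the sum of `(cz+d)^{-k}` over all coprime `(c,d)`. -/
theorem eisenstein_apply {k : ℕ} (hk : 3 ≤ k) (z : ℍ) :
    ModularForm.E hk z =
      1 / 2 * ∑' v : {v : Fin 2 → ℤ // IsCoprime (v 0) (v 1)},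
        1 / ((v.1 0 : ℂ) * (z : ℂ) + (v.1 1 : ℂ)) ^ k := by
  have h1 : ModularForm.E hk z = (1 / 2 : ℂ) * eisensteinSeries (N := 1) 0 (k : ℤ) z := rfl
  rw [h1, eisensteinSeries]
  congr 1
  refine (Equiv.tsum_eq
    (Equiv.subtypeEquivRight (fun v => (EisensteinSeries.mem_gammaSet_one v)))
    (fun v : {v : Fin 2 → ℤ // IsCoprime (v 0) (v 1)} =>
      1 / ((v.1 0 : ℂ) * (z : ℂ) + (v.1 1 : ℂ)) ^ k)).symm.trans ?_ |>.symm
  refine tsum_congr fun v => ?_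
  simp [EisensteinSeries.eisSummand, Equiv.subtypeEquivRight]
  rfl

/-- The zeros of `Δ_{k,ℓ}` on the side `x = 1/2`, `y > √3/2` of the standard fundamental domain. -/
def sideZeros {k ℓ : ℕ} (hk : 4 ≤ k) (hℓ : 4 ≤ ℓ) : Set ℍ :=
  {z | z.re = 1 / 2 ∧ Real.sqrt 3 / 2 < z.im ∧ eisensteinDelta hk hℓ z = 0}

/-- `B_{k,ℓ}`: the number of (distinct) zeros of `Δ_{k,ℓ}` on the side `x = 1/2`, `y > √3/2`. -/
def sideZeroCount {k ℓ : ℕ} (hk : 4 ≤ k) (hℓ : 4 ≤ ℓ) : ℕ :=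
  (sideZeros hk hℓ).ncard

/-- The stabilization point `sp_j(ℓ)`. -/
def stabPoint (j ℓ : ℕ) : ℝ :=
  if ℓ % 6 = 0 ∧ j % 6 = 2 then
    ((ℓ : ℝ) - 1 + Real.sqrt (3 * (ℓ : ℝ) ^ 2 - 1)) / 2
  else if ℓ % 6 = 4 ∧ j % 6 = 2 then
    2 * (ℓ : ℝ)
  else if ℓ % 6 = 4 ∧ j % 6 = 0 then
    (4 * (ℓ : ℝ) - 1 + Real.sqrt (12 * (ℓ : ℝ) ^ 2 - 12 * (ℓ : ℝ) + 1)) / 2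
  else
    (ℓ : ℝ)

/-- `T'_{k,ℓ}` (for even `ℓ`; it depends on `ℓ` only): `⌊ℓ/6⌋` if `ℓ ≡ 4 (mod 6)`, and `⌊ℓ/6⌋ - 1`
if `ℓ ≡ 0, 2 (mod 6)`. -/
def sideBound (ℓ : ℕ) : ℤ :=
  if ℓ % 6 = 4 then ⌊(ℓ : ℝ) / 6⌋ else ⌊(ℓ : ℝ) / 6⌋ - 1

end

/-!
On the line `z = 1/2 + iy` every Eisenstein series of even weight is real, so zeros of
`Δ = E_k E_ℓ - E_{k+ℓ}` on the side of the fundamental domain come from sign changes. Write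
`z = e^{iθ} / (2 cos θ)` with `π/3 ≤ θ < π/2`, `p = k - ℓ` and `E_n = 1 + e_n`, so that
`Δ = e_k + e_ℓ + e_k e_ℓ - e_{k+ℓ}`.

The signs are taken at the points with `ℓθ = π (ℓ/2 - m)` for `1 ≤ m < ℓ/6`, where `cos (ℓθ) = ±1`
alternates with `m` (`sign_lineDelta_sampleAngle`).

* For bounded `|z|` the four terms `(±z)^{-n}`, `(±(z - 1))^{-n}` give `e_n` up to an error
  which is exponentially smaller in `n` than `|z|^{-n}`, and `Δ ≈ 2 (2 cos θ)^ℓ A` with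
  `A = cos ℓθ + (2 cos θ)^p cos kθ + (2 cos θ)^k cos pθ` (`abs_lineDelta_sub_mainTerm_le`). At a
  sample point the first summand wins, because `(2 cos θ)^p cos pθ ≥ -1/2` for all even `p`
  (`mainTerm_sampleAngle`).
* For `|z|` up to the order of `ℓ` many terms `(z + d)^{-ℓ}` are of comparable size, but their
  arguments at a sample point are close to odd multiples of one and the same angle, so that all
  those which are not negligible have the same sign and no cancellation occurs
  (`sign_mul_re_lineTerm_ge`, `lineDelta_sampleAngle_high`). The terms of weight `k > ℓ` are smaller
  by a factor `|z|^{ℓ-k}`, and for `k = ℓ` they double those of weight `ℓ`.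

For `ℓ ≡ 2` modulo `6` these points suffice. For `ℓ ≡ 0, 4` one more sign change is found next to
the corner `θ = π/3` (`exists_corner_sample`). If `A` does not vanish at the corner its value there
gives the sign; if it does, the first or second order term of its Taylor expansion in `θ - π/3`
does. The coefficient of that term is a polynomial in `k` and `ℓ`, and `k ≥ sp_j(ℓ)` says that it
has the required sign (`stabPoint_zero_two`, `stabPoint_four_two`, `stabPoint_four_zero`). Being an integer,
or `√3` times an integer, it is bounded away from zero, and the exponentially small error can be
beaten by an angle `θ - π/3` which is itself exponentially small.

Finiteness holds because `Δ` is analytic in `q = e^{2πiz}` up to the cusp `q = 0` and not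
identically zero (`finite_sideZeros`).
-/

/-! ### Eisenstein series on the line `Re z = 1/2` -/

/-- The point `1/2 + iy` of the line `Re z = 1/2`. -/
noncomputable def linePt (y : ℝ) : ℂ := ⟨1 / 2, y⟩

/-- The term `(cz+d)^{-n}` at `z = 1/2 + iy`, extended by zero to the pairs which are not coprime
and to those with `c = 0`. -/
noncomputable def lineTerm (y : ℝ) (n : ℕ) (v : ℤ × ℤ) : ℂ :=
  open Classical in
  if IsCoprime v.1 v.2 ∧ v.1 ≠ 0 then 1 / ((v.1 : ℂ) * linePt y + v.2) ^ n else 0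

lemma normSq_denom (y : ℝ) (c d : ℤ) :
    ‖(c : ℂ) * linePt y + d‖ ^ 2 = (2 * d + c : ℝ) ^ 2 / 4 + (c : ℝ) ^ 2 * y ^ 2 := by
  rw [← Complex.normSq_eq_norm_sq, Complex.normSq_apply]
  simp [linePt]
  ring

lemma three_quarters_le_sq {y : ℝ} (hy : √3 / 2 ≤ y) : 3 / 4 ≤ y ^ 2 := by
  have h3 : (√3) ^ 2 = 3 := Real.sq_sqrt (by norm_num)
  have h0 := Real.sqrt_nonneg 3
  nlinarith

lemma pos_of_sqrt_three_le {y : ℝ} (hy : √3 / 2 ≤ y) : 0 < y := by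
  have h0 : 0 < √3 := Real.sqrt_pos.2 (by norm_num)
  linarith

/-- `|cz+d| ≥ √3 |z|` for `|c| ≥ 2`, `z = 1/2 + iy` and `y ≥ √3/2`. -/
lemma normSq_denom_ge_three {y : ℝ} (hy : √3 / 2 ≤ y) {c : ℤ} (hc : 2 ≤ |c|) (d : ℤ) :
    3 * (1 / 4 + y ^ 2) ≤ ‖(c : ℂ) * linePt y + d‖ ^ 2 := by
  rw [normSq_denom]
  have h1 : (4 : ℝ) ≤ (c : ℝ) ^ 2 := by
    have : (4 : ℤ) ≤ c ^ 2 := by nlinarith [sq_abs c]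
    exact_mod_cast this
  have := three_quarters_le_sq hy
  nlinarith [sq_nonneg (2 * d + c : ℝ)]

lemma normSq_denom_of_abs_eq_one (y : ℝ) {c : ℤ} (hc : |c| = 1) (d : ℤ) :
    ‖(c : ℂ) * linePt y + d‖ ^ 2 = (2 * d + c : ℝ) ^ 2 / 4 + y ^ 2 := by
  have : (c : ℝ) ^ 2 = 1 := by
    have : c ^ 2 = 1 := by rw [← sq_abs, hc]; norm_num
    exact_mod_cast this
  rw [normSq_denom, this, one_mul]

/-- `|cz+d| ≥ |z|` for `c ≠ 0`. -/
lemma normSq_denom_ge {y : ℝ} (hy : √3 / 2 ≤ y) {c : ℤ} (hc : c ≠ 0) (d : ℤ) :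
    1 / 4 + y ^ 2 ≤ ‖(c : ℂ) * linePt y + d‖ ^ 2 := by
  by_cases h2 : 2 ≤ |c|
  · have := normSq_denom_ge_three hy h2 d
    nlinarith [sq_nonneg y]
  · have h1 : |c| = 1 := by
      have := abs_pos.2 hc
      omega
    rw [normSq_denom_of_abs_eq_one y h1]
    have : (1 : ℝ) ≤ (2 * d + c : ℝ) ^ 2 := by
      have : (1 : ℤ) ≤ (2 * d + c) ^ 2 := by
        have h0 : 2 * d + c ≠ 0 := by
          rcases eq_or_eq_neg_of_abs_eq h1 with h | h <;> omega
        have := sq_pos_of_ne_zero h0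
        omega
      exact_mod_cast this
    linarith

lemma norm_lineTerm (y : ℝ) (n : ℕ) {v : ℤ × ℤ} (h : IsCoprime v.1 v.2 ∧ v.1 ≠ 0) :
    ‖lineTerm y n v‖ = (‖(v.1 : ℂ) * linePt y + v.2‖ ^ n)⁻¹ := by
  simp [lineTerm, h]

lemma lineTerm_eq_zero (y : ℝ) (n : ℕ) {v : ℤ × ℤ} (h : ¬ (IsCoprime v.1 v.2 ∧ v.1 ≠ 0)) :
    lineTerm y n v = 0 := by
  unfold lineTerm
  rw [if_neg h]

/-- The decay of a term in `n` when `|cz+d| ≥ R`. -/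
lemma norm_lineTerm_le {y R : ℝ} (hR : 0 < R) {m n : ℕ} (hmn : m ≤ n) {v : ℤ × ℤ}
    (h : IsCoprime v.1 v.2 → v.1 ≠ 0 → R ^ 2 ≤ ‖(v.1 : ℂ) * linePt y + v.2‖ ^ 2) :
    ‖lineTerm y n v‖ ≤ (R ^ (n - m))⁻¹ * ‖lineTerm y m v‖ := by
  by_cases hv : IsCoprime v.1 v.2 ∧ v.1 ≠ 0
  · rw [norm_lineTerm y n hv, norm_lineTerm y m hv, ← mul_inv]
    have h1 : R ≤ ‖(v.1 : ℂ) * linePt y + v.2‖ :=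
      le_of_sq_le_sq (h hv.1 hv.2) (norm_nonneg _)
    have h2 : ‖(v.1 : ℂ) * linePt y + v.2‖ ^ n
        = ‖(v.1 : ℂ) * linePt y + v.2‖ ^ (n - m) * ‖(v.1 : ℂ) * linePt y + v.2‖ ^ m := by
      rw [← pow_add]; congr 1; omega
    have h0 : 0 < ‖(v.1 : ℂ) * linePt y + v.2‖ := hR.trans_le h1
    rw [h2]
    gcongr
  · simp [lineTerm_eq_zero _ _ hv]

/-- A summable majorant for the terms of weight `4`, from `|cz+d|² = (2d+c)²/4 + c²y²`. The value at
`c = 0` is `0`, by division by zero. -/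
noncomputable def latticeMajorant (v : ℤ × ℤ) : ℝ :=
  6 * ((1 / (1 + (2 * v.2 + v.1 : ℤ) ^ 2 : ℝ)) * (1 / (v.1 : ℝ) ^ 2))

lemma summable_latticeMajorant : Summable latticeMajorant := by
  have h1 : Summable (fun e : ℤ => 1 / (1 + (e : ℝ) ^ 2)) := by
    refine Summable.of_norm_bounded_eventually (Real.summable_one_div_int_pow.2 one_lt_two) ?_
    rw [Filter.eventually_cofinite]
    refine (Set.finite_singleton (0 : ℤ)).subset fun e he => ?_
    by_contra h0
    apply he
    have : (0 : ℝ) < (e : ℝ) ^ 2 := by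
      have : (e : ℝ) ≠ 0 := by simpa using h0
      positivity
    rw [Real.norm_of_nonneg (by positivity)]
    gcongr
    linarith
  have h2 : Summable (fun c : ℤ => 1 / (c : ℝ) ^ 2) := Real.summable_one_div_int_pow.2 one_lt_two
  have h3 := (h1.mul_of_nonneg h2 (fun _ => by positivity) (fun _ => by positivity)).mul_left 6
  refine h3.comp_injective (i := fun v : ℤ × ℤ => (2 * v.2 + v.1, v.1)) ?_
  rintro ⟨c, d⟩ ⟨c', d'⟩ h
  simp only [Prod.mk.injEq] at h ⊢
  omega

lemma norm_lineTerm_four_le {y : ℝ} (hy : √3 / 2 ≤ y) (v : ℤ × ℤ) :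
    ‖lineTerm y 4 v‖ ≤ latticeMajorant v := by
  by_cases hv : IsCoprime v.1 v.2 ∧ v.1 ≠ 0
  · rw [norm_lineTerm y 4 hv]
    have hy2 := three_quarters_le_sq hy
    have hc : (1 : ℝ) ≤ (v.1 : ℝ) ^ 2 := by
      have : 1 ≤ v.1 ^ 2 := by
        have := sq_pos_of_ne_zero hv.2
        omega
      exact_mod_cast this
    have hX := normSq_denom y v.1 v.2
    rw [show ‖(v.1 : ℂ) * linePt y + v.2‖ ^ 4 = (‖(v.1 : ℂ) * linePt y + v.2‖ ^ 2) ^ 2 by ring]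
    set X := ‖(v.1 : ℂ) * linePt y + v.2‖ ^ 2
    have e1 : latticeMajorant v
        = ((1 + (2 * v.2 + v.1 : ℝ) ^ 2) * (v.1 : ℝ) ^ 2 / 6)⁻¹ := by
      unfold latticeMajorant
      push_cast
      field_simp
    rw [e1]
    have a1 : (1 + (2 * v.2 + v.1 : ℝ) ^ 2) / 4 ≤ X := by nlinarith
    have a2 : 3 / 4 * (v.1 : ℝ) ^ 2 ≤ X := by nlinarith [sq_nonneg (2 * v.2 + v.1 : ℝ)]
    apply inv_anti₀ (by positivity)
    have := mul_le_mul a1 a2 (by positivity) (le_trans (by positivity) a1)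
    nlinarith [mul_nonneg (show (0:ℝ) ≤ 1 + (2 * v.2 + v.1 : ℝ) ^ 2 by positivity)
      (show (0:ℝ) ≤ (v.1 : ℝ) ^ 2 by positivity)]
  · rw [lineTerm_eq_zero _ _ hv, norm_zero]
    unfold latticeMajorant
    positivity

/-- A bound for `∑ |cz+d|^{-4}` over the pairs with `c ≠ 0`, uniform on the line. -/
noncomputable def latticeConst : ℝ := ∑' v, latticeMajorant v

lemma latticeConst_nonneg : 0 ≤ latticeConst :=
  tsum_nonneg fun _ => by unfold latticeMajorant; positivity

lemma summable_norm_lineTerm_four {y : ℝ} (hy : √3 / 2 ≤ y) :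
    Summable fun v => ‖lineTerm y 4 v‖ :=
  Summable.of_nonneg_of_le (fun _ => norm_nonneg _) (norm_lineTerm_four_le hy)
    summable_latticeMajorant

lemma tsum_norm_lineTerm_four_le {y : ℝ} (hy : √3 / 2 ≤ y) :
    ∑' v, ‖lineTerm y 4 v‖ ≤ latticeConst :=
  (summable_norm_lineTerm_four hy).tsum_le_tsum (norm_lineTerm_four_le hy)
    summable_latticeMajorant

/-- The modulus of `1/2 + iy`. -/
noncomputable def lineNorm (y : ℝ) : ℝ := √(1 / 4 + y ^ 2)

lemma lineNorm_sq (y : ℝ) : lineNorm y ^ 2 = 1 / 4 + y ^ 2 := Real.sq_sqrt (by positivity)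

lemma lineNorm_pos (y : ℝ) : 0 < lineNorm y := Real.sqrt_pos.2 (by positivity)

lemma one_le_lineNorm {y : ℝ} (hy : √3 / 2 ≤ y) : 1 ≤ lineNorm y :=
  Real.one_le_sqrt.2 (by linarith [three_quarters_le_sq hy])

lemma norm_lineTerm_le_lineNorm {y : ℝ} (hy : √3 / 2 ≤ y) {m n : ℕ} (hmn : m ≤ n) (v : ℤ × ℤ) :
    ‖lineTerm y n v‖ ≤ (lineNorm y ^ (n - m))⁻¹ * ‖lineTerm y m v‖ :=
  norm_lineTerm_le (lineNorm_pos y) hmn fun _ h => by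
    rw [lineNorm_sq]; exact normSq_denom_ge hy h _

lemma summable_norm_lineTerm {y : ℝ} (hy : √3 / 2 ≤ y) {n : ℕ} (hn : 4 ≤ n) :
    Summable fun v => ‖lineTerm y n v‖ :=
  Summable.of_nonneg_of_le (fun _ => norm_nonneg _)
    (norm_lineTerm_le_lineNorm hy hn) ((summable_norm_lineTerm_four hy).mul_left _)

lemma summable_lineTerm {y : ℝ} (hy : √3 / 2 ≤ y) {n : ℕ} (hn : 4 ≤ n) :
    Summable (lineTerm y n) := (summable_norm_lineTerm hy hn).of_norm

/-- `T_n = ½ ∑ |cz+d|^{-n}` over the coprime pairs with `c ≠ 0`. -/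
noncomputable def lineAbsSum (y : ℝ) (n : ℕ) : ℝ := 1 / 2 * ∑' v, ‖lineTerm y n v‖

/-- `e_n = E_n - 1` on the line `Re z = 1/2`, a real number. -/
noncomputable def lineTail (y : ℝ) (n : ℕ) : ℝ := 1 / 2 * ∑' v, (lineTerm y n v).re

lemma summable_re_lineTerm {y : ℝ} (hy : √3 / 2 ≤ y) {n : ℕ} (hn : 4 ≤ n) :
    Summable fun v => (lineTerm y n v).re :=
  Summable.of_norm_bounded (summable_norm_lineTerm hy hn) fun v =>
    Complex.abs_re_le_norm (lineTerm y n v)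

lemma abs_lineTail_le {y : ℝ} (hy : √3 / 2 ≤ y) {n : ℕ} (hn : 4 ≤ n) :
    |lineTail y n| ≤ lineAbsSum y n := by
  unfold lineTail lineAbsSum
  rw [abs_mul, abs_of_pos (by norm_num : (0 : ℝ) < 1 / 2)]
  rw [← Real.norm_eq_abs]
  exact mul_le_mul_of_nonneg_left (tsum_of_norm_bounded (summable_norm_lineTerm hy hn).hasSum
    fun v => Complex.abs_re_le_norm (lineTerm y n v)) (by norm_num)

lemma lineAbsSum_le {y : ℝ} (hy : √3 / 2 ≤ y) {m n : ℕ} (hm : 4 ≤ m) (hmn : m ≤ n) :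
    lineAbsSum y n ≤ (lineNorm y ^ (n - m))⁻¹ * lineAbsSum y m := by
  have h := (summable_norm_lineTerm hy (hm.trans hmn)).tsum_le_tsum
    (norm_lineTerm_le_lineNorm hy hmn) ((summable_norm_lineTerm hy hm).mul_left _)
  rw [tsum_mul_left] at h
  unfold lineAbsSum
  rw [mul_left_comm]
  exact mul_le_mul_of_nonneg_left h (by norm_num)

lemma lineAbsSum_four_le {y : ℝ} (hy : √3 / 2 ≤ y) : lineAbsSum y 4 ≤ latticeConst := by
  have h1 := tsum_norm_lineTerm_four_le hy
  have h2 := latticeConst_nonneg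
  unfold lineAbsSum
  linarith

/-- The terms of an even weight come in conjugate pairs: complex conjugation on the line is the
map `z ↦ 1 - z`, which sends `(c, d)` to `(c, -c-d)` up to sign. -/
lemma conj_lineTerm (y : ℝ) {n : ℕ} (hn : Even n) (v : ℤ × ℤ) :
    (starRingEnd ℂ) (lineTerm y n v) = lineTerm y n (v.1, -v.1 - v.2) := by
  have hiff : (IsCoprime v.1 (-v.1 - v.2) ∧ v.1 ≠ 0) ↔ (IsCoprime v.1 v.2 ∧ v.1 ≠ 0) := by
    have : IsCoprime v.1 (-v.1 - v.2) ↔ IsCoprime v.1 v.2 := by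
      rw [show -v.1 - v.2 = -(v.2 + v.1 * 1) by ring, IsCoprime.neg_right_iff,
        IsCoprime.add_mul_left_right_iff]
    rw [this]
  by_cases hv : IsCoprime v.1 v.2 ∧ v.1 ≠ 0
  · unfold lineTerm
    rw [if_pos hv, if_pos (hiff.2 hv)]
    simp only [map_div₀, map_one, map_pow]
    rw [← hn.neg_pow]
    congr 2
    apply Complex.ext <;> simp [linePt]
    ring
  · rw [lineTerm_eq_zero _ _ hv, lineTerm_eq_zero _ _ (mt hiff.1 hv), map_zero]

lemma tsum_lineTerm {y : ℝ} (hy : √3 / 2 ≤ y) {n : ℕ} (hn : 4 ≤ n) (he : Even n) :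
    (1 / 2 : ℂ) * ∑' v, lineTerm y n v = (lineTail y n : ℂ) := by
  let e : ℤ × ℤ ≃ ℤ × ℤ :=
    { toFun := fun v => (v.1, -v.1 - v.2)
      invFun := fun v => (v.1, -v.1 - v.2)
      left_inv := fun v => by ext <;> simp
      right_inv := fun v => by ext <;> simp }
  have h1 : (starRingEnd ℂ) (∑' v, lineTerm y n v) = ∑' v, lineTerm y n v := by
    rw [Complex.conj_tsum]
    simp_rw [conj_lineTerm y he]
    exact e.tsum_eq (lineTerm y n)
  rw [Complex.conj_eq_iff_re] at h1
  unfold lineTail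
  rw [← h1, Complex.re_tsum (summable_lineTerm hy hn)]
  push_cast
  rfl

/-- The point `1/2 + iy` of the upper half-plane. -/
noncomputable def linePtH (y : ℝ) (hy : 0 < y) : ℍ := ⟨linePt y, hy⟩

/-- On the line `E_n` is the real number `1 + e_n`: the pairs `(0, ±1)` contribute `1`. -/
lemma eisenstein_linePt {y : ℝ} (hy : √3 / 2 ≤ y) {n : ℕ} (hn : 4 ≤ n) (h3 : 3 ≤ n)
    (he : Even n) :
    ModularForm.E h3 (linePtH y (pos_of_sqrt_three_le hy)) = ((1 + lineTail y n : ℝ) : ℂ) := by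
  classical
  rw [eisenstein_apply]
  set S : Set (Fin 2 → ℤ) := {v | IsCoprime (v 0) (v 1)}
  set F : (Fin 2 → ℤ) → ℂ := fun v => 1 / ((v 0 : ℂ) * linePt y + (v 1 : ℂ)) ^ n
  have h1 : (∑' v : {v : Fin 2 → ℤ // IsCoprime (v 0) (v 1)},
      1 / ((v.1 0 : ℂ) * (linePtH y (pos_of_sqrt_three_le hy) : ℂ) + (v.1 1 : ℂ)) ^ n)
      = ∑' v, S.indicator F v := tsum_subtype S F
  have h2 : ∑' v, S.indicator F v
      = ∑' v : ℤ × ℤ, S.indicator F ((finTwoArrowEquiv ℤ).symm v) :=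
    ((finTwoArrowEquiv ℤ).symm.tsum_eq _).symm
  set B : ℤ × ℤ → ℂ := fun v => if v ∈ ({(0, 1), (0, -1)} : Finset (ℤ × ℤ)) then 1 else 0
  have h4 : ∀ v : ℤ × ℤ, S.indicator F ((finTwoArrowEquiv ℤ).symm v) = lineTerm y n v + B v := by
    rintro ⟨c, d⟩
    by_cases hcop : IsCoprime c d
    · have hS : (finTwoArrowEquiv ℤ).symm (c, d) ∈ S := hcop
      rw [Set.indicator_of_mem hS]
      by_cases hc : c = 0
      · subst hc
        rw [lineTerm_eq_zero _ _ (by simp), isCoprime_zero_left, Int.isUnit_iff] at *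
        rcases hcop with rfl | rfl
        · simp [F, B]
        · simp [F, B, he.neg_one_pow]
      · simp [F, B, lineTerm, hcop, hc]
    · have hS : (finTwoArrowEquiv ℤ).symm (c, d) ∉ S := hcop
      rw [Set.indicator_of_notMem hS, lineTerm_eq_zero _ _ (by simp [hcop])]
      have : ¬ ((c, d) ∈ ({(0, 1), (0, -1)} : Finset (ℤ × ℤ))) := by
        intro hm
        simp only [Finset.mem_insert, Finset.mem_singleton, Prod.mk.injEq] at hm
        rcases hm with ⟨rfl, rfl⟩ | ⟨rfl, rfl⟩ <;> exact hcop (by simp [isCoprime_zero_left])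
      simp only [B, if_neg this, add_zero]
  have hB : HasSum B 2 := by
    have : HasSum B (∑ v ∈ ({(0, 1), (0, -1)} : Finset (ℤ × ℤ)), B v) :=
      hasSum_sum_of_ne_finset_zero fun b hb => by simp only [B, if_neg hb]
    convert this using 1
    rw [Finset.sum_pair (by decide)]
    norm_num [B]
  rw [h1, h2]
  simp_rw [h4]
  rw [(summable_lineTerm hy hn).tsum_add hB.summable, hB.tsum_eq, mul_add, tsum_lineTerm hy hn he]
  push_cast
  ring

/-- `Δ_{k,ℓ}` on the line `Re z = 1/2`, in terms of `e_n = E_n - 1`. -/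
noncomputable def lineDelta (k ℓ : ℕ) (y : ℝ) : ℝ :=
  lineTail y k + lineTail y ℓ + lineTail y k * lineTail y ℓ - lineTail y (k + ℓ)

lemma eisensteinDelta_linePt {y : ℝ} (hy : √3 / 2 ≤ y) {k ℓ : ℕ} (hk : 4 ≤ k) (hℓ : 4 ≤ ℓ)
    (ek : Even k) (eℓ : Even ℓ) :
    eisensteinDelta hk hℓ (linePtH y (pos_of_sqrt_three_le hy)) = (lineDelta k ℓ y : ℂ) := by
  unfold eisensteinDelta lineDelta
  rw [eisenstein_linePt hy hk _ ek, eisenstein_linePt hy hℓ _ eℓ,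
    eisenstein_linePt hy (by omega) _ (ek.add eℓ)]
  push_cast
  ring

/-- Near the corner the four terms `(±z)^{-n}`, `(±(z-1))^{-n}` dominate `E_n - 1`. -/
lemma abs_lineTail_sub_le {y : ℝ} (hy : √3 / 2 ≤ y) (h8 : lineNorm y ^ 2 ≤ 8) {n : ℕ}
    (hn : 4 ≤ n) (he : Even n) :
    |lineTail y n - 2 * ((linePt y ^ n)⁻¹).re|
      ≤ 50 * latticeConst * √(4 / 5) ^ n * (lineNorm y ^ n)⁻¹ := by
  classical
  set M : Finset (ℤ × ℤ) := {(1, 0), (-1, 0), (1, -1), (-1, 1)}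
  set B : ℤ × ℤ → ℝ := fun v => if v ∈ M then (lineTerm y n v).re else 0
  have hB : HasSum B (4 * ((linePt y ^ n)⁻¹).re) := by
    have : HasSum B (∑ v ∈ M, B v) :=
      hasSum_sum_of_ne_finset_zero fun b hb => by simp only [B, if_neg hb]
    convert this using 1
    have c1 : lineTerm y n (1, 0) = (linePt y ^ n)⁻¹ := by
      simp [lineTerm, isCoprime_zero_right]
    have c2 : lineTerm y n (-1, 0) = (linePt y ^ n)⁻¹ := by
      simp [lineTerm, isCoprime_zero_right, he.neg_pow]
    have c3 : lineTerm y n (1, -1) = (starRingEnd ℂ) (linePt y ^ n)⁻¹ := by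
      rw [← c1, conj_lineTerm y he]; simp
    have c4 : lineTerm y n (-1, 1) = (starRingEnd ℂ) (linePt y ^ n)⁻¹ := by
      rw [← c2, conj_lineTerm y he]; simp
    rw [Finset.sum_congr rfl
      (fun v hv => show B v = (lineTerm y n v).re by simp only [B, if_pos hv])]
    simp only [M]
    rw [Finset.sum_insert (by decide), Finset.sum_insert (by decide),
      Finset.sum_insert (by decide), Finset.sum_singleton, c1, c2, c3, c4, Complex.conj_re]
    ring
  -- a pair with `c = ±1` outside `M` has `|2d+c| ≥ 3`, so `|cz+d|² ≥ |z|² + 2 ≥ 5/4 |z|²`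
  set R : ℝ := √(5 / 4) * lineNorm y
  have hR : 0 < R := mul_pos (Real.sqrt_pos.2 (by norm_num)) (lineNorm_pos y)
  have hR2 : R ^ 2 = 5 / 4 * lineNorm y ^ 2 := by
    rw [mul_pow, Real.sq_sqrt (by norm_num)]
  have hpt : ∀ v, ‖(lineTerm y n v).re - B v‖ ≤ (R ^ (n - 4))⁻¹ * ‖lineTerm y 4 v‖ := by
    rintro ⟨c, d⟩
    by_cases hm : (c, d) ∈ M
    · simp only [B, if_pos hm, sub_self, norm_zero]
      positivity
    · simp only [B, if_neg hm, sub_zero]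
      refine (Complex.abs_re_le_norm _).trans (norm_lineTerm_le hR hn fun _ hc => ?_)
      rw [hR2]
      dsimp only at hc ⊢
      by_cases h2 : 2 ≤ |c|
      · have := normSq_denom_ge_three hy h2 d
        rw [← lineNorm_sq] at this
        nlinarith [sq_nonneg (lineNorm y)]
      · have h1 : |c| = 1 := by
          have := abs_pos.2 hc
          omega
        rw [normSq_denom_of_abs_eq_one y h1]
        have h9 : (9 : ℝ) ≤ (2 * d + c : ℝ) ^ 2 := by
          have : (9 : ℤ) ≤ (2 * d + c) ^ 2 := by
            simp only [M, Finset.mem_insert, Finset.mem_singleton, Prod.mk.injEq, not_or] at hm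
            have : 3 ≤ 2 * d + c ∨ 2 * d + c ≤ -3 := by
              rcases eq_or_eq_neg_of_abs_eq h1 with h | h <;> omega
            rcases this with h | h <;> nlinarith
          exact_mod_cast this
        rw [lineNorm_sq] at h8 ⊢
        linarith
  have hs := summable_re_lineTerm hy hn
  have e1 : lineTail y n - 2 * ((linePt y ^ n)⁻¹).re
      = 1 / 2 * ∑' v, ((lineTerm y n v).re - B v) := by
    rw [hs.tsum_sub hB.summable, hB.tsum_eq, lineTail]
    ring
  rw [e1, abs_mul, abs_of_pos (by norm_num : (0 : ℝ) < 1 / 2)]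
  have h3 := tsum_of_norm_bounded ((summable_norm_lineTerm_four hy).mul_left _).hasSum hpt
  rw [tsum_mul_left] at h3
  have h4 : (R ^ (n - 4))⁻¹ * ∑' v, ‖lineTerm y 4 v‖ ≤ (R ^ (n - 4))⁻¹ * latticeConst := by
    gcongr
    exact tsum_norm_lineTerm_four_le hy
  have h5 : (R ^ (n - 4))⁻¹ = R ^ 4 * (R ^ n)⁻¹ := by
    rw [show R ^ n = R ^ 4 * R ^ (n - 4) by rw [← pow_add]; congr 1; omega]
    field_simp
  have h6 : (R ^ n)⁻¹ = √(4 / 5) ^ n * (lineNorm y ^ n)⁻¹ := by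
    rw [mul_pow, mul_inv, ← inv_pow, ← Real.sqrt_inv]
    norm_num
  have h7 : R ^ 4 ≤ 100 := by
    rw [show R ^ 4 = (R ^ 2) ^ 2 by ring, hR2]
    nlinarith [sq_nonneg (lineNorm y)]
  rw [Real.norm_eq_abs] at h3
  calc _ ≤ 1 / 2 * ((R ^ 4 * (R ^ n)⁻¹) * latticeConst) := by
        rw [← h5]; linarith
    _ ≤ 1 / 2 * ((100 * (R ^ n)⁻¹) * latticeConst) := by
        have := latticeConst_nonneg
        gcongr
    _ = _ := by rw [h6]; ring

/-! ### The main term in polar coordinates -/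

/-- In polar coordinates `1/z = 2 cos θ e^{-iθ}` for `z = 1/2 + (i/2) tan θ`. -/
lemma linePt_inv_eq {θ : ℝ} (hθ : Real.cos θ ≠ 0) :
    (linePt (Real.tan θ / 2))⁻¹
      = (2 * Real.cos θ : ℝ) * (Real.cos θ - Real.sin θ * Complex.I : ℂ) := by
  apply inv_eq_of_mul_eq_one_left
  have h1 := Real.sin_sq_add_cos_sq θ
  apply Complex.ext
  · simp [linePt, Real.tan_eq_sin_div_cos, -Complex.ofReal_cos, -Complex.ofReal_sin]
    field_simp
    linarith
  · simp [linePt, Real.tan_eq_sin_div_cos, -Complex.ofReal_cos, -Complex.ofReal_sin]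
    field_simp
    ring

/-- With `z = 1/2 + (i/2) tan θ = e^{iθ} / (2 cos θ)`, the real part of `z^{-n}`. -/
lemma linePt_pow_inv_re {θ : ℝ} (hθ : Real.cos θ ≠ 0) (n : ℕ) :
    ((linePt (Real.tan θ / 2) ^ n)⁻¹).re = (2 * Real.cos θ) ^ n * Real.cos (n * θ) := by
  rw [← inv_pow, linePt_inv_eq hθ, mul_pow]
  have h : (Real.cos θ - Real.sin θ * Complex.I : ℂ)
      = Complex.exp (((-θ : ℝ) : ℂ) * Complex.I) := by
    rw [Complex.exp_mul_I, ← Complex.ofReal_cos, ← Complex.ofReal_sin, Real.cos_neg, Real.sin_neg]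
    push_cast
    ring
  rw [h, ← Complex.exp_nat_mul, ← mul_assoc, ← Complex.ofReal_natCast, ← Complex.ofReal_mul,
    ← Complex.ofReal_pow, Complex.re_ofReal_mul, Complex.exp_ofReal_mul_I_re]
  rw [mul_neg, Real.cos_neg]

lemma lineNorm_tan {θ : ℝ} (hθ : 0 < Real.cos θ) :
    lineNorm (Real.tan θ / 2) = (2 * Real.cos θ)⁻¹ := by
  unfold lineNorm
  rw [Real.sqrt_eq_iff_mul_self_eq_of_pos (by positivity), Real.tan_eq_sin_div_cos]
  have h1 := Real.sin_sq_add_cos_sq θ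
  field_simp
  linarith

/-- Up to the factor `2 (2 cos θ)^ℓ`, the main term of `Δ_{ℓ+p,ℓ}` at the point
`e^{iθ} / (2 cos θ)` of the line. -/
noncomputable def mainTerm (ℓ p : ℕ) (θ : ℝ) : ℝ :=
  Real.cos (ℓ * θ) + (2 * Real.cos θ) ^ p * Real.cos ((ℓ + p : ℕ) * θ)
    + (2 * Real.cos θ) ^ (ℓ + p) * Real.cos (p * θ)

lemma tan_pi_div_three_le {θ : ℝ} (h1 : Real.pi / 3 ≤ θ) (h2 : θ < Real.pi / 2) :
    √3 / 2 ≤ Real.tan θ / 2 := by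
  rw [← Real.tan_pi_div_three]
  have := Real.strictMonoOn_tan.monotoneOn (a := Real.pi / 3) (b := θ)
    ⟨by linarith [Real.pi_pos], by linarith [Real.pi_pos]⟩ ⟨by linarith [Real.pi_pos], h2⟩ h1
  linarith

lemma cos_pos_of_lt {θ : ℝ} (h1 : Real.pi / 3 ≤ θ) (h2 : θ < Real.pi / 2) : 0 < Real.cos θ :=
  Real.cos_pos_of_mem_Ioo ⟨by linarith [Real.pi_pos], h2⟩

lemma two_cos_le_one {θ : ℝ} (h1 : Real.pi / 3 ≤ θ) (h2 : θ < Real.pi / 2) :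
    2 * Real.cos θ ≤ 1 := by
  have := Real.cos_le_cos_of_nonneg_of_le_pi (by linarith [Real.pi_pos]) (by linarith [Real.pi_pos])
    h1
  rw [Real.cos_pi_div_three] at this
  linarith

/-- The constant in the error of the main term. -/
noncomputable def errConst : ℝ := (7 + 50 * latticeConst) * (50 * latticeConst)

lemma errConst_nonneg : 0 ≤ errConst := by
  have := latticeConst_nonneg
  unfold errConst
  positivity

/-- The approximation of `Δ_{ℓ+p,ℓ}` by its main term for `|z|² ≤ 8`. The products of cosines in
`e_k e_ℓ - e_{k+ℓ}` combine by `2 cos a cos b - cos (a + b) = cos (a - b)`. -/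
lemma abs_lineDelta_sub_mainTerm_le {θ : ℝ} (h1 : Real.pi / 3 ≤ θ) (h2 : θ < Real.pi / 2)
    (h8 : 1 ≤ 8 * (2 * Real.cos θ) ^ 2) {ℓ p : ℕ} (hℓ : 4 ≤ ℓ) (eℓ : Even ℓ) (ep : Even p) :
    |lineDelta (ℓ + p) ℓ (Real.tan θ / 2) - 2 * (2 * Real.cos θ) ^ ℓ * mainTerm ℓ p θ|
      ≤ errConst * √(4 / 5) ^ ℓ * (2 * Real.cos θ) ^ ℓ := by
  have hc := cos_pos_of_lt h1 h2
  have hy := tan_pi_div_three_le h1 h2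
  have ha1 := two_cos_le_one h1 h2
  have hn8 : lineNorm (Real.tan θ / 2) ^ 2 ≤ 8 := by
    rw [lineNorm_tan hc, inv_pow]
    exact inv_le_of_inv_le₀ (by norm_num) (by linarith)
  have key : ∀ n : ℕ, ℓ ≤ n → Even n →
      |lineTail (Real.tan θ / 2) n - 2 * ((2 * Real.cos θ) ^ n * Real.cos (n * θ))|
        ≤ 50 * latticeConst * √(4 / 5) ^ ℓ * (2 * Real.cos θ) ^ ℓ := by
    intro n hn en
    have := abs_lineTail_sub_le hy hn8 (hℓ.trans hn) en
    rw [linePt_pow_inv_re hc.ne', lineNorm_tan hc, inv_pow, inv_inv] at this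
    refine this.trans ?_
    have hC := latticeConst_nonneg
    have hq : √(4 / 5 : ℝ) ≤ 1 := Real.sqrt_le_one.2 (by norm_num)
    gcongr ?_ * ?_ * ?_ * ?_
    · exact pow_le_pow_of_le_one (Real.sqrt_nonneg _) hq hn
    · exact pow_le_pow_of_le_one (by positivity) ha1 hn
  have k1 := key (ℓ + p) (by omega) (eℓ.add ep)
  have k2 := key ℓ le_rfl eℓ
  have k3 := key (ℓ + p + ℓ) (by omega) ((eℓ.add ep).add eℓ)
  set a := 2 * Real.cos θ
  have hapos : 0 < a := by positivity
  have hub : ∀ n : ℕ, |2 * (a ^ n * Real.cos (n * θ))| ≤ 2 := by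
    intro n
    rw [abs_mul, abs_mul, abs_two, abs_of_pos (pow_pos hapos n)]
    have := pow_le_one₀ (n := n) hapos.le ha1
    have := Real.abs_cos_le_one (n * θ)
    have := mul_le_mul ‹a ^ n ≤ 1› this (abs_nonneg _) zero_le_one
    linarith
  have u1 := hub (ℓ + p)
  have u2 := hub ℓ
  have hprod : 2 * (a ^ (ℓ + p) * Real.cos ((ℓ + p : ℕ) * θ)) * (2 * (a ^ ℓ * Real.cos (ℓ * θ)))
      - 2 * (a ^ (ℓ + p + ℓ) * Real.cos ((ℓ + p + ℓ : ℕ) * θ))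
      = 2 * a ^ ℓ * (a ^ (ℓ + p) * Real.cos (p * θ)) := by
    have e1 : ((ℓ + p + ℓ : ℕ) : ℝ) * θ = (ℓ + p : ℕ) * θ + ℓ * θ := by push_cast; ring
    have e2 : (p : ℝ) * θ = (ℓ + p : ℕ) * θ - ℓ * θ := by push_cast; ring
    rw [e1, e2, Real.cos_add, Real.cos_sub, pow_add a (ℓ + p) ℓ]
    ring
  have hmain : 2 * a ^ ℓ * mainTerm ℓ p θ
      = 2 * (a ^ (ℓ + p) * Real.cos ((ℓ + p : ℕ) * θ)) + 2 * (a ^ ℓ * Real.cos (ℓ * θ))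
        + 2 * (a ^ (ℓ + p) * Real.cos ((ℓ + p : ℕ) * θ)) * (2 * (a ^ ℓ * Real.cos (ℓ * θ)))
        - 2 * (a ^ (ℓ + p + ℓ) * Real.cos ((ℓ + p + ℓ : ℕ) * θ)) := by
    rw [add_sub_assoc, hprod, mainTerm]
    simp only [a]
    ring
  rw [hmain]
  unfold lineDelta
  set E := 50 * latticeConst * √(4 / 5) ^ ℓ * a ^ ℓ
  have hC := latticeConst_nonneg
  have hE1 : E ≤ 50 * latticeConst := by
    have hq : √(4 / 5 : ℝ) ^ ℓ ≤ 1 :=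
      pow_le_one₀ (Real.sqrt_nonneg _) (Real.sqrt_le_one.2 (by norm_num))
    have ha : a ^ ℓ ≤ 1 := pow_le_one₀ hapos.le ha1
    have h3 : √(4 / 5 : ℝ) ^ ℓ * a ^ ℓ ≤ 1 := mul_le_one₀ hq (by positivity) ha
    calc E = 50 * latticeConst * (√(4 / 5) ^ ℓ * a ^ ℓ) := by ring
      _ ≤ 50 * latticeConst * 1 := by gcongr
      _ = _ := mul_one _
  have hE0 : 0 ≤ E := (abs_nonneg _).trans k2
  set U := 2 * (a ^ (ℓ + p) * Real.cos ((ℓ + p : ℕ) * θ))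
  set V := 2 * (a ^ ℓ * Real.cos (ℓ * θ))
  set W := 2 * (a ^ (ℓ + p + ℓ) * Real.cos ((ℓ + p + ℓ : ℕ) * θ))
  set x := lineTail (Real.tan θ / 2) (ℓ + p) - U with hx
  set z := lineTail (Real.tan θ / 2) ℓ - V with hz
  set w := lineTail (Real.tan θ / 2) (ℓ + p + ℓ) - W with hw
  have e : lineTail (Real.tan θ / 2) (ℓ + p) + lineTail (Real.tan θ / 2) ℓ
      + lineTail (Real.tan θ / 2) (ℓ + p) * lineTail (Real.tan θ / 2) ℓ
      - lineTail (Real.tan θ / 2) (ℓ + p + ℓ) - (U + V + U * V - W)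
      = x + z + U * z + x * V + x * z - w := by
    rw [hx, hz, hw]; ring
  rw [e]
  have b1 : |U * z| ≤ 2 * E := by rw [abs_mul]; gcongr
  have b2 : |x * V| ≤ E * 2 := by rw [abs_mul]; gcongr
  have b3 : |x * z| ≤ E * (50 * latticeConst) := by
    rw [abs_mul]
    exact mul_le_mul k1 (k2.trans hE1) (abs_nonneg _) hE0
  have hfin : errConst * √(4 / 5) ^ ℓ * a ^ ℓ = 7 * E + E * (50 * latticeConst) := by
    simp only [E, errConst]; ring
  rw [hfin]
  rw [abs_le] at k1 k2 k3 b1 b2 b3 ⊢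
  constructor <;> linarith [k1.1, k1.2, k2.1, k2.2, k3.1, k3.2, b1.1, b1.2, b2.1, b2.2, b3.1, b3.2]

/-! ### Elementary inequalities for the main term -/

lemma two_cos_add_eq (ψ : ℝ) :
    2 * Real.cos (Real.pi / 3 + ψ) = Real.cos ψ - √3 * Real.sin ψ := by
  rw [Real.cos_add, Real.cos_pi_div_three, Real.sin_pi_div_three]
  ring

/-- The product of `2 cos (π/3 + ψ)` and `exp (√3 ψ)` has the derivative `-4 exp (√3 ψ) sin ψ`. -/
lemma two_cos_le_exp {ψ : ℝ} (h0 : 0 ≤ ψ) (h1 : ψ ≤ Real.pi) :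
    2 * Real.cos (Real.pi / 3 + ψ) ≤ Real.exp (-(√3 * ψ)) := by
  set f : ℝ → ℝ := fun x => Real.exp (√3 * x) * (Real.cos x - √3 * Real.sin x)
  have hd : ∀ x, HasDerivAt f (-4 * (Real.exp (√3 * x) * Real.sin x)) x := by
    intro x
    have a1 : HasDerivAt (fun x => Real.exp (√3 * x)) (Real.exp (√3 * x) * √3) x := by
      simpa using ((hasDerivAt_id x).const_mul √3).exp
    have a2 : HasDerivAt (fun x => Real.cos x - √3 * Real.sin x)
        (-Real.sin x - √3 * Real.cos x) x :=
      (Real.hasDerivAt_cos x).sub ((Real.hasDerivAt_sin x).const_mul √3)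
    refine (a1.mul a2).congr_deriv ?_
    have h3 : √3 * √3 = 3 := Real.mul_self_sqrt (by norm_num)
    linear_combination (-Real.exp (√3 * x) * Real.sin x) * h3
  have hanti : AntitoneOn f (Set.Icc 0 Real.pi) := by
    apply antitoneOn_of_deriv_nonpos (convex_Icc _ _)
    · exact fun x _ => (hd x).continuousAt.continuousWithinAt
    · exact fun x _ => (hd x).differentiableAt.differentiableWithinAt
    · intro x hx
      rw [interior_Icc] at hx
      rw [(hd x).deriv]
      have := Real.sin_pos_of_pos_of_lt_pi hx.1 hx.2
      have := mul_pos (Real.exp_pos (√3 * x)) this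
      linarith
  have := hanti ⟨le_rfl, h0.trans h1⟩ ⟨h0, h1⟩ h0
  simp only [f, mul_zero, Real.exp_zero, Real.cos_zero, Real.sin_zero, sub_zero, mul_one] at this
  rw [two_cos_add_eq, Real.exp_neg, ← one_div, le_div_iff₀ (Real.exp_pos _)]
  linarith

lemma two_cos_pow_le_exp {ψ : ℝ} (h0 : 0 ≤ ψ) (h1 : ψ ≤ Real.pi / 6) (p : ℕ) :
    (2 * Real.cos (Real.pi / 3 + ψ)) ^ p ≤ Real.exp (-(√3 * (p * ψ))) := by
  have hc : 0 ≤ Real.cos (Real.pi / 3 + ψ) :=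
    Real.cos_nonneg_of_mem_Icc ⟨by linarith [Real.pi_pos], by linarith [Real.pi_pos]⟩
  calc _ ≤ (Real.exp (-(√3 * ψ))) ^ p := by
        gcongr
        exact two_cos_le_exp h0 (by linarith [Real.pi_pos])
    _ = _ := by rw [← Real.exp_nat_mul]; ring_nf

lemma cos_nat_mul_add {p i s : ℕ} (hp : p = 6 * s + i) (ψ : ℝ) :
    Real.cos (p * (Real.pi / 3 + ψ)) = Real.cos (i * (Real.pi / 3) + p * ψ) := by
  have : (p : ℝ) * (Real.pi / 3 + ψ)
      = (i * (Real.pi / 3) + p * ψ) + (s : ℕ) * (2 * Real.pi) := by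
    subst hp; push_cast; ring
  rw [this, Real.cos_add_nat_mul_two_pi]

lemma cos_two_pi_div_three_add (x : ℝ) :
    Real.cos ((2 : ℕ) * (Real.pi / 3) + x) = -(Real.cos x) / 2 - √3 / 2 * Real.sin x := by
  rw [show ((2 : ℕ) : ℝ) * (Real.pi / 3) + x = Real.pi - (Real.pi / 3 - x) by push_cast; ring,
    Real.cos_pi_sub, Real.cos_sub, Real.cos_pi_div_three, Real.sin_pi_div_three]
  ring

lemma cos_four_pi_div_three_add (x : ℝ) :
    Real.cos ((4 : ℕ) * (Real.pi / 3) + x) = -(Real.cos x) / 2 + √3 / 2 * Real.sin x := by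
  rw [show ((4 : ℕ) : ℝ) * (Real.pi / 3) + x = (Real.pi / 3 + x) + Real.pi by push_cast; ring,
    Real.cos_add_pi, Real.cos_add, Real.cos_pi_div_three, Real.sin_pi_div_three]
  ring

/-- For even `p` one has `Re z^{-p} ≥ -1/2` on the line above the corner. -/
lemma neg_half_le_two_cos_pow_mul_cos {ψ : ℝ} (h0 : 0 ≤ ψ) (h1 : ψ ≤ Real.pi / 6) {p : ℕ}
    (ep : Even p) :
    -(1 / 2) ≤ (2 * Real.cos (Real.pi / 3 + ψ)) ^ p * Real.cos (p * (Real.pi / 3 + ψ)) := by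
  have hc : 0 ≤ Real.cos (Real.pi / 3 + ψ) :=
    Real.cos_nonneg_of_mem_Icc ⟨by linarith [Real.pi_pos], by linarith [Real.pi_pos]⟩
  have ha := two_cos_pow_le_exp h0 h1 p
  have hapos : 0 ≤ (2 * Real.cos (Real.pi / 3 + ψ)) ^ p := by positivity
  set x : ℝ := p * ψ
  have hx : 0 ≤ x := by positivity
  have h3 : (0 : ℝ) ≤ √3 := Real.sqrt_nonneg 3
  have h3' : (1.7 : ℝ) ≤ √3 := Real.le_sqrt_of_sq_le (by norm_num)
  -- `-cos (pθ)` grows at most linearly, with the slope which `exp (-√3 x) ≤ 1 / (1 + √3 x)` absorbs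
  have hcos : -(1 / 2 + √3 / 2 * x) ≤ Real.cos (p * (Real.pi / 3 + ψ)) := by
    have hsx := Real.sin_le hx
    have hsx' := Real.neg_one_le_sin x
    have hcx := Real.cos_le_one x
    have : p % 6 = 0 ∨ p % 6 = 2 ∨ p % 6 = 4 := by
      have := Nat.even_iff.1 ep
      omega
    rcases this with h | h | h
    · rw [cos_nat_mul_add (p := p) (i := 0) (s := p / 6) (by omega)]
      simp only [Nat.cast_zero, zero_mul, zero_add]
      by_cases hx2 : x ≤ Real.pi / 2
      · have := Real.cos_nonneg_of_mem_Icc (x := x) ⟨by linarith [Real.pi_pos], hx2⟩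
        change _ ≤ Real.cos x
        nlinarith [mul_nonneg h3 hx]
      · have := Real.neg_one_le_cos x
        change _ ≤ Real.cos x
        have := Real.pi_gt_three
        nlinarith
    · rw [cos_nat_mul_add (p := p) (i := 2) (s := p / 6) (by omega), cos_two_pi_div_three_add]
      change _ ≤ -(Real.cos x) / 2 - √3 / 2 * Real.sin x
      nlinarith
    · rw [cos_nat_mul_add (p := p) (i := 4) (s := p / 6) (by omega), cos_four_pi_div_three_add]
      change _ ≤ -(Real.cos x) / 2 + √3 / 2 * Real.sin x
      have : -x ≤ Real.sin x := by
        have := Real.sin_le hx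
        have := Real.abs_sin_le_abs (x := x)
        rw [abs_of_nonneg hx, abs_le] at this
        linarith
      nlinarith
  have hexp : Real.exp (-(√3 * x)) * (1 + √3 * x) ≤ 1 := by
    have := Real.add_one_le_exp (√3 * x)
    rw [Real.exp_neg, inv_mul_le_iff₀ (Real.exp_pos _)]
    linarith
  have h4 : (2 * Real.cos (Real.pi / 3 + ψ)) ^ p * (1 + √3 * x) ≤ 1 :=
    (mul_le_mul_of_nonneg_right ha (by positivity)).trans hexp
  nlinarith [mul_le_mul_of_nonneg_left hcos hapos]

/-! ### The sample points -/

/-- The angle `θ` with `ℓθ = π (ℓ/2 - m)`. -/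
noncomputable def sampleAngle (ℓ m : ℕ) : ℝ := Real.pi / 2 - Real.pi * m / ℓ

lemma cos_mul_sampleAngle {h ℓ m : ℕ} (hℓ : ℓ = 2 * h) (hpos : 0 < ℓ) :
    Real.cos (ℓ * sampleAngle ℓ m) = (-1) ^ (h + m) ∧ Real.sin (ℓ * sampleAngle ℓ m) = 0 := by
  have hne : (ℓ : ℝ) ≠ 0 := by positivity
  have e : (ℓ : ℝ) * sampleAngle ℓ m = h * Real.pi - m * Real.pi := by
    unfold sampleAngle
    rw [mul_sub, mul_div_cancel₀ _ hne, hℓ]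
    push_cast
    ring
  rw [e, Real.cos_sub, Real.sin_sub, Real.cos_nat_mul_pi, Real.cos_nat_mul_pi,
    Real.sin_nat_mul_pi, Real.sin_nat_mul_pi]
  constructor <;> ring

lemma sampleAngle_eq {ℓ m : ℕ} : sampleAngle ℓ m
    = Real.pi / 3 + (Real.pi / 6 - Real.pi * m / ℓ) := by
  unfold sampleAngle; ring

/-- At a sample point the first summand of the main term, which is `±1`, decides the sign. -/
lemma mainTerm_sampleAngle {h ℓ m p : ℕ} (hℓ : ℓ = 2 * h) (hm : 6 * m + 2 ≤ ℓ) (ep : Even p) :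
    1 / 4 ≤ (-1) ^ (h + m) * mainTerm ℓ p (sampleAngle ℓ m) := by
  have hpos : 0 < ℓ := by omega
  have hposR : (0 : ℝ) < ℓ := by exact_mod_cast hpos
  obtain ⟨hc, hs⟩ := cos_mul_sampleAngle (m := m) hℓ hpos
  have hmR : (6 * m + 2 : ℝ) ≤ ℓ := by exact_mod_cast hm
  have hψ : ℓ * (Real.pi / 6 - Real.pi * m / ℓ) = Real.pi * (ℓ - 6 * m) / 6 := by
    field_simp
  set ψ := Real.pi / 6 - Real.pi * m / ℓ with hψdef
  have hpi := Real.pi_gt_three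
  have hψ1 : 1 ≤ ℓ * ψ := by rw [hψ]; nlinarith
  have h0 : 0 ≤ ψ := by
    by_contra hcon
    push Not at hcon
    nlinarith
  have h1 : ψ ≤ Real.pi / 6 := by
    have : 0 ≤ Real.pi * m / ℓ := by positivity
    linarith
  have hB := neg_half_le_two_cos_pow_mul_cos h0 h1 ep
  have hA := two_cos_pow_le_exp h0 h1 ℓ
  have hhalf : Real.exp (-(√3 * (ℓ * ψ))) ≤ 1 / 2 := by
    have h3' : (1.7 : ℝ) ≤ √3 := Real.le_sqrt_of_sq_le (by norm_num)
    have := Real.add_one_le_exp (√3 * (ℓ * ψ))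
    rw [Real.exp_neg, ← one_div]
    exact one_div_le_one_div_of_le (by norm_num) (by nlinarith)
  have hcnn : 0 ≤ Real.cos (Real.pi / 3 + ψ) :=
    Real.cos_nonneg_of_mem_Icc ⟨by linarith [Real.pi_pos], by linarith [Real.pi_pos]⟩
  have hann : 0 ≤ (2 * Real.cos (Real.pi / 3 + ψ)) ^ ℓ := by positivity
  have hθ : sampleAngle ℓ m = Real.pi / 3 + ψ := sampleAngle_eq
  rw [← hθ] at hB hA hann
  set θ := sampleAngle ℓ m
  have hsum : Real.cos ((ℓ + p : ℕ) * θ) = (-1) ^ (h + m) * Real.cos (p * θ) := by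
    rw [show ((ℓ + p : ℕ) : ℝ) * θ = ℓ * θ + p * θ by push_cast; ring, Real.cos_add, hc, hs]
    ring
  unfold mainTerm
  rw [hsum, hc, pow_add (2 * Real.cos θ)]
  set A := (2 * Real.cos θ) ^ ℓ
  set B := (2 * Real.cos θ) ^ p * Real.cos (p * θ) with hBdef
  have e : ∀ σ : ℝ, σ * σ = 1 → σ * (σ + (2 * Real.cos θ) ^ p * (σ * Real.cos (p * θ))
      + A * (2 * Real.cos θ) ^ p * Real.cos (p * θ)) = 1 + B * (1 + σ * A) := by
    intro σ hσ
    rw [hBdef]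
    linear_combination (1 + (2 * Real.cos θ) ^ p * Real.cos (p * θ)) * hσ
  have hA2 : A ≤ 1 / 2 := hA.trans hhalf
  rcases neg_one_pow_eq_or ℝ (h + m) with hσ | hσ <;> rw [hσ, e _ (by norm_num)] <;> nlinarith

/-! ### The sample points high above the corner -/

lemma abs_arctan_sub_le (x : ℝ) : |Real.arctan x - x| ≤ |x| ^ 3 / 3 := by
  wlog hx : 0 ≤ x generalizing x
  · have := this (-x) (by linarith)
    rw [Real.arctan_neg, abs_neg, ← abs_neg] at this
    convert this using 2
    ring
  have h1 : Real.arctan x ≤ x := by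
    have hanti : AntitoneOn (fun u => Real.arctan u - u) (Set.Ici 0) := by
      have hd : ∀ u, HasDerivAt (fun u => Real.arctan u - u) (1 / (1 + u ^ 2) - 1) u :=
        fun u => (Real.hasDerivAt_arctan u).sub (hasDerivAt_id u)
      refine antitoneOn_of_deriv_nonpos (convex_Ici _)
        (fun u _ => (hd u).continuousAt.continuousWithinAt)
        (fun u _ => (hd u).differentiableAt.differentiableWithinAt) fun u _ => ?_
      rw [(hd u).deriv]
      rw [sub_nonpos, div_le_one (by positivity)]
      nlinarith
    simpa using hanti (a := 0) (b := x) (by simp) hx hx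
  have h2 : x - x ^ 3 / 3 ≤ Real.arctan x := by
    have hmono : MonotoneOn (fun u => Real.arctan u - (u - u ^ 3 / 3)) (Set.Ici 0) := by
      have hd : ∀ u, HasDerivAt (fun u => Real.arctan u - (u - u ^ 3 / 3))
          (1 / (1 + u ^ 2) - (1 - ((3 : ℕ) : ℝ) * u ^ (3 - 1) / 3)) u :=
        fun u => (Real.hasDerivAt_arctan u).sub ((hasDerivAt_id u).sub
          ((hasDerivAt_pow 3 u).div_const 3))
      refine monotoneOn_of_deriv_nonneg (convex_Ici _)
        (fun u _ => (hd u).continuousAt.continuousWithinAt)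
        (fun u _ => (hd u).differentiableAt.differentiableWithinAt) fun u _ => ?_
      rw [(hd u).deriv]
      have : 0 < 1 + u ^ 2 := by positivity
      rw [sub_nonneg, le_div_iff₀ this]
      norm_num
      nlinarith [sq_nonneg (u ^ 2)]
    simpa using hmono (a := 0) (b := x) (by simp) hx hx
  rw [abs_of_nonneg hx, abs_le]
  constructor <;> nlinarith [pow_nonneg hx 3]

/-- The real part of `w^{-2h}` for `w = iy(1 - iu)`. -/
lemma re_inv_pow_eq (y u : ℝ) (h : ℕ) :
    (((y * Complex.I * (1 - u * Complex.I) : ℂ) ^ (2 * h))⁻¹).re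
      = (-1) ^ h * Real.cos ((2 * h : ℕ) * Real.arctan u)
        * (‖(y * Complex.I * (1 - u * Complex.I) : ℂ)‖ ^ (2 * h))⁻¹ := by
  set α := Real.arctan u
  have hcα : 0 < Real.cos α := Real.cos_arctan_pos u
  have hu : u = Real.sin α / Real.cos α := by
    rw [← Real.tan_eq_sin_div_cos, Real.tan_arctan]
  have h1 : (1 - u * Complex.I : ℂ)
      = ((Real.cos α)⁻¹ : ℝ) * Complex.exp (((-α : ℝ) : ℂ) * Complex.I) := by
    rw [Complex.exp_mul_I, ← Complex.ofReal_cos, ← Complex.ofReal_sin, Real.cos_neg, Real.sin_neg]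
    have hc' : ((Real.cos α : ℝ) : ℂ) ≠ 0 := by exact_mod_cast hcα.ne'
    rw [hu]
    push_cast at hc' ⊢
    field_simp
    ring
  have hn : ‖(y * Complex.I * (1 - u * Complex.I) : ℂ)‖ = |y| * (Real.cos α)⁻¹ := by
    rw [h1, norm_mul, norm_mul, norm_mul, Complex.norm_exp_ofReal_mul_I, Complex.norm_I,
      Complex.norm_real, Complex.norm_real, Real.norm_eq_abs, Real.norm_eq_abs,
      abs_of_pos (inv_pos.2 hcα)]
    ring
  have h2 : ((y * Complex.I * (1 - u * Complex.I) : ℂ) ^ (2 * h))⁻¹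
      = (((-1) ^ h * ((|y| * (Real.cos α)⁻¹) ^ (2 * h))⁻¹ : ℝ) : ℂ)
        * Complex.exp (((2 * h : ℕ) * α : ℝ) * Complex.I) := by
    rw [h1, mul_pow, mul_pow, mul_pow, ← Complex.exp_nat_mul, mul_inv, mul_inv, mul_inv,
      ← Complex.exp_neg, pow_mul Complex.I, Complex.I_sq, mul_pow, pow_mul |y|, sq_abs, ← pow_mul]
    rw [← inv_pow (-1 : ℂ), show ((-1 : ℂ))⁻¹ = -1 by norm_num]
    push_cast
    rw [mul_inv]
    ring_nf
  rw [h2, Complex.re_ofReal_mul, Complex.exp_ofReal_mul_I_re, hn]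
  ring

/-- For odd `K` the angle `ℓ arctan (K tan φ)`, `φ = πm/ℓ`, is close to `K m π` as long as
`K tan φ` is small, so its cosine has the sign `(-1)^m` for all these `K` simultaneously. -/
lemma half_le_cos_arctan {ℓ m : ℕ} (hm : 2 * m < ℓ) {K : ℤ} (hK : Odd K)
    (h : |K| = 1 ∨ ℓ * |K * Real.tan (Real.pi * m / ℓ)| ^ 3 ≤ 1) :
    1 / 2 ≤ (-1) ^ m * Real.cos (ℓ * Real.arctan (K * Real.tan (Real.pi * m / ℓ))) := by
  have hposR : (0 : ℝ) < ℓ := by exact_mod_cast (by omega : 0 < ℓ)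
  set φ := Real.pi * m / ℓ with hφ
  have hmR : (2 * m : ℝ) < ℓ := by exact_mod_cast hm
  have hφ0 : 0 ≤ φ := by positivity
  have hφ1 : φ < Real.pi / 2 := by
    rw [hφ, div_lt_div_iff₀ hposR two_pos]
    nlinarith [Real.pi_pos]
  have hat : Real.arctan (Real.tan φ) = φ := Real.arctan_tan (by linarith [Real.pi_pos]) hφ1
  set D := ℓ * Real.arctan (K * Real.tan φ) - (K * m : ℤ) * Real.pi with hD
  have hℓφ : ℓ * φ = m * Real.pi := by rw [hφ]; field_simp
  have hdev : |D| ≤ 1 := by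
    rcases h with h | h
    · have : D = 0 := by
        rcases eq_or_eq_neg_of_abs_eq h with h | h
        · rw [hD, h]; push_cast; rw [one_mul, one_mul, hat, hℓφ, sub_self]
        · rw [hD, h]; push_cast
          rw [neg_one_mul, Real.arctan_neg, hat, mul_neg, hℓφ]; ring
      rw [this]; norm_num
    · have e : D = ℓ * ((Real.arctan (K * Real.tan φ) - K * Real.tan φ)
          - K * (Real.arctan (Real.tan φ) - Real.tan φ)) := by
        rw [hat, hD]
        push_cast
        linear_combination (K : ℝ) * hℓφ
      have b1 := abs_arctan_sub_le (K * Real.tan φ)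
      have b2 := abs_arctan_sub_le (Real.tan φ)
      have hK1 : (1 : ℝ) ≤ |(K : ℝ)| := by
        have : 1 ≤ |K| := Int.one_le_abs (by rintro rfl; simp at hK)
        exact_mod_cast this
      have b3 : |(K : ℝ)| * (|Real.tan φ| ^ 3 / 3) ≤ |K * Real.tan φ| ^ 3 / 3 := by
        rw [abs_mul, mul_pow]
        have : |(K : ℝ)| ≤ |(K : ℝ)| ^ 3 := le_self_pow₀ hK1 (by norm_num)
        have := mul_le_mul_of_nonneg_right this (pow_nonneg (abs_nonneg (Real.tan φ)) 3)
        linarith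
      have b4 : |(Real.arctan (K * Real.tan φ) - K * Real.tan φ)
          - K * (Real.arctan (Real.tan φ) - Real.tan φ)| ≤ 2 / 3 * |K * Real.tan φ| ^ 3 := by
        refine (abs_sub _ _).trans ?_
        rw [abs_mul (K : ℝ) (Real.arctan (Real.tan φ) - Real.tan φ)]
        have := mul_le_mul_of_nonneg_left b2 (abs_nonneg (K : ℝ))
        linarith
      rw [e, abs_mul, abs_of_pos hposR]
      have := mul_le_mul_of_nonneg_left b4 hposR.le
      linarith
  have e2 : ℓ * Real.arctan (K * Real.tan φ) = D + (K * m : ℤ) * Real.pi := by rw [hD]; ring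
  rw [e2, Real.cos_add_int_mul_pi, zpow_mul, hK.neg_one_zpow, zpow_natCast, ← mul_assoc,
    ← mul_pow, neg_one_mul, neg_neg, one_pow, one_mul]
  have := Real.one_sub_sq_div_two_le_cos (x := D)
  have h2 := sq_le_one_iff_abs_le_one D |>.2 hdev
  linarith

/-- Every term of weight `ℓ` at a sample point either has the sign of the leading term, with a real
part at least half its modulus, or is much smaller than the leading term. The parameter `x`
separates the cases `|c(2d+c)| tan φ ≤ x` and `> x` for `c = ±1`. -/
lemma sign_mul_re_lineTerm_ge {h ℓ m : ℕ} (hℓ : ℓ = 2 * h) (h4 : 4 ≤ ℓ) (hm0 : 0 < m)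
    (hm : 6 * m + 2 ≤ ℓ) {x : ℝ} (hx0 : 0 < x) (hx1 : x ≤ 1) (hx : ℓ * x ^ 3 ≤ 1) (v : ℤ × ℤ) :
    1 / 2 * ‖lineTerm (Real.tan (sampleAngle ℓ m) / 2) ℓ v‖
      - 2 * (((√(1 + 2 / 3 * x ^ 2) * lineNorm (Real.tan (sampleAngle ℓ m) / 2)) ^ (ℓ - 4))⁻¹
        * ‖lineTerm (Real.tan (sampleAngle ℓ m) / 2) 4 v‖)
      ≤ (-1) ^ (h + m) * (lineTerm (Real.tan (sampleAngle ℓ m) / 2) ℓ v).re := by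
  have hposR : (0 : ℝ) < ℓ := by exact_mod_cast (by omega : 0 < ℓ)
  have hmR : (6 * m + 2 : ℝ) ≤ ℓ := by exact_mod_cast hm
  have hm0R : (0 : ℝ) < m := by exact_mod_cast hm0
  set φ := Real.pi * m / ℓ with hφ
  have hpi := Real.pi_pos
  have hφ0 : 0 < φ := by positivity
  have hφ1 : φ ≤ Real.pi / 6 := by
    rw [hφ, div_le_div_iff₀ hposR (by norm_num)]
    nlinarith
  set t := Real.tan φ
  have ht0 : 0 < t := Real.tan_pos_of_pos_of_lt_pi_div_two hφ0 (by linarith)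
  have ht1 : t ^ 2 ≤ 1 / 3 := by
    have h1 : t ≤ 1 / √3 := by
      rw [← Real.tan_pi_div_six]
      exact Real.strictMonoOn_tan.monotoneOn ⟨by linarith, by linarith⟩
        ⟨by linarith, by linarith⟩ hφ1
    calc t ^ 2 ≤ (1 / √3) ^ 2 := by gcongr
      _ = 1 / 3 := by rw [div_pow, Real.sq_sqrt (by norm_num)]; norm_num
  have hy : Real.tan (sampleAngle ℓ m) / 2 = 1 / (2 * t) := by
    rw [sampleAngle, Real.tan_pi_div_two_sub]
    change t⁻¹ / 2 = _
    field_simp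
  rw [hy]
  set y := 1 / (2 * t) with hydef
  have hypos : 0 < y := by positivity
  have hy3 : √3 / 2 ≤ y := by
    rw [hydef, div_le_div_iff₀ two_pos (by positivity)]
    have h3 : √3 * t ≤ 1 := by
      have : (√3 * t) ^ 2 ≤ 1 ^ 2 := by
        rw [mul_pow, Real.sq_sqrt (by norm_num)]; linarith
      exact le_of_sq_le_sq this (by norm_num)
    linarith
  have hs1 : ∀ b : ℝ, |(-1 : ℝ) ^ (h + m) * b| = |b| := by
    intro b; rw [abs_mul, abs_pow, abs_neg, abs_one, one_pow, one_mul]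
  set R := √(1 + 2 / 3 * x ^ 2) * lineNorm y with hRdef
  have hR : 0 < R := mul_pos (Real.sqrt_pos.2 (by positivity)) (lineNorm_pos y)
  have hR2 : R ^ 2 = (1 + 2 / 3 * x ^ 2) * lineNorm y ^ 2 := by
    rw [hRdef, mul_pow, Real.sq_sqrt (by positivity)]
  have hx2 : x ^ 2 ≤ 1 := pow_le_one₀ hx0.le hx1
  by_cases hv : IsCoprime v.1 v.2 ∧ v.1 ≠ 0
  swap
  · simp [lineTerm_eq_zero _ _ hv]
  by_cases hgood : |v.1| = 1 ∧ (|v.1 * (2 * v.2 + v.1)| = 1 ∨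
      ℓ * |(v.1 * (2 * v.2 + v.1) : ℤ) * t| ^ 3 ≤ 1)
  · obtain ⟨hc, hg⟩ := hgood
    set K : ℤ := v.1 * (2 * v.2 + v.1) with hKdef
    have hcc : v.1 * v.1 = 1 := by
      rcases eq_or_eq_neg_of_abs_eq hc with h | h <;> rw [h] <;> norm_num
    have hKodd : Odd K := ⟨v.1 * v.2, by rw [hKdef]; linear_combination hcc⟩
    have hcos := half_le_cos_arctan (by omega) hKodd hg
    have hccR : (v.1 : ℝ) * v.1 = 1 := by exact_mod_cast hcc
    have hw : (v.1 : ℂ) * linePt y + v.2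
        = ((v.1 * y : ℝ) : ℂ) * Complex.I * (1 - ((K * t : ℝ) : ℂ) * Complex.I) := by
      have hyt : y * t = 1 / 2 := by rw [hydef]; field_simp
      apply Complex.ext
      · simp [linePt, hKdef]
        linear_combination (-(v.1 : ℝ) * v.1 * (2 * v.2 + v.1)) * hyt
          - (v.2 + v.1 / 2) * hccR
      · simp [linePt]
    have hre : (lineTerm y ℓ v).re
        = (-1) ^ h * Real.cos (ℓ * Real.arctan (K * t)) * ‖lineTerm y ℓ v‖ := by
      rw [norm_lineTerm y ℓ hv, lineTerm, if_pos hv, one_div, hw]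
      have := re_inv_pow_eq (v.1 * y) (K * t) h
      rw [← hℓ] at this
      exact this
    have hsq : ((-1 : ℝ) ^ h) * (-1) ^ h = 1 := by rw [← mul_pow]; norm_num
    have e : (-1) ^ (h + m) * ((-1) ^ h * Real.cos (ℓ * Real.arctan (K * t)) * ‖lineTerm y ℓ v‖)
        = ((-1) ^ m * Real.cos (ℓ * Real.arctan (K * t))) * ‖lineTerm y ℓ v‖ := by
      rw [pow_add]
      linear_combination ((-1) ^ m * Real.cos (ℓ * Real.arctan (K * t)) * ‖lineTerm y ℓ v‖) * hsq
    rw [hre, e]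
    have h1 := mul_le_mul_of_nonneg_right hcos (norm_nonneg (lineTerm y ℓ v))
    have h2 : 0 ≤ 2 * ((R ^ (ℓ - 4))⁻¹ * ‖lineTerm y 4 v‖) := by positivity
    linarith
  · have hbad : R ^ 2 ≤ ‖(v.1 : ℂ) * linePt y + v.2‖ ^ 2 := by
      rw [hR2]
      by_cases h2 : 2 ≤ |v.1|
      · have h3 := normSq_denom_ge_three hy3 h2 v.2
        rw [lineNorm_sq]
        nlinarith [sq_nonneg y]
      · have hc : |v.1| = 1 := by
          have := abs_pos.2 hv.2
          omega
        push Not at hgood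
        obtain ⟨hK1, hK2⟩ := hgood hc
        set K : ℤ := v.1 * (2 * v.2 + v.1) with hKdef
        have hcc : v.1 * v.1 = 1 := by
          rcases eq_or_eq_neg_of_abs_eq hc with h | h <;> rw [h] <;> norm_num
        have hK9 : (9 : ℝ) ≤ (K : ℝ) ^ 2 := by
          have : (9 : ℤ) ≤ K ^ 2 := by
            have hKodd : K = 2 * (v.1 * v.2) + 1 := by rw [hKdef]; linear_combination hcc
            have : 3 ≤ K ∨ K ≤ -3 := by
              by_contra hcon
              push Not at hcon
              apply hK1
              have : K = 1 ∨ K = -1 := by omega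
              rcases this with h | h <;> rw [h] <;> norm_num
            rcases this with h | h <;> nlinarith
          exact_mod_cast this
        have hKx : x ^ 2 ≤ (K : ℝ) ^ 2 * t ^ 2 := by
          by_contra hcon
          push Not at hcon
          rw [← mul_pow, ← sq_abs ((K : ℝ) * t)] at hcon
          have hlt : |(K : ℝ) * t| ≤ x := (lt_of_pow_lt_pow_left₀ 2 hx0.le hcon).le
          have : ℓ * |(K : ℝ) * t| ^ 3 ≤ ℓ * x ^ 3 := by gcongr
          linarith
        rw [normSq_denom_of_abs_eq_one y hc, lineNorm_sq]
        have hKsq : (2 * v.2 + v.1 : ℝ) ^ 2 = (K : ℝ) ^ 2 := by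
          have : (v.1 : ℝ) * v.1 = 1 := by exact_mod_cast hcc
          rw [hKdef]
          push_cast
          linear_combination (-(2 * v.2 + v.1 : ℝ) ^ 2) * this
        rw [hKsq]
        have hy2 : y ^ 2 * (4 * t ^ 2) = 1 := by rw [hydef]; field_simp; norm_num
        have hmul : (1 + 2 / 3 * x ^ 2) * (1 + t ^ 2) ≤ 1 + K ^ 2 * t ^ 2 := by
          have : 9 * t ^ 2 ≤ (K : ℝ) ^ 2 * t ^ 2 := by gcongr
          nlinarith [sq_nonneg x]
        have ht2 : 0 < 4 * t ^ 2 := by positivity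
        refine le_of_mul_le_mul_right ?_ ht2
        nlinarith
    have hb := norm_lineTerm_le hR h4 (v := v) fun _ _ => hbad
    have h1 := Complex.abs_re_le_norm (lineTerm y ℓ v)
    rw [← hs1, abs_le] at h1
    linarith [h1.1, norm_nonneg (lineTerm y ℓ v)]

lemma inv_lineNorm_pow_le {y : ℝ} (hy : √3 / 2 ≤ y) {ℓ : ℕ} (h4 : 4 ≤ ℓ) :
    (lineNorm y ^ ℓ)⁻¹ ≤ lineAbsSum y ℓ := by
  have h1 := (summable_norm_lineTerm hy h4).sum_le_tsum ({(1, 0), (-1, 0)} : Finset (ℤ × ℤ))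
    fun _ _ => norm_nonneg _
  have hn : ∀ c : ℤ, |c| = 1 → ‖lineTerm y ℓ (c, 0)‖ = (lineNorm y ^ ℓ)⁻¹ := by
    intro c hc
    have hu : IsUnit c := Int.isUnit_iff_abs_eq.2 hc
    rw [norm_lineTerm y ℓ ⟨isCoprime_zero_right.2 hu, hu.ne_zero⟩]
    congr 2
    have h2 := normSq_denom_of_abs_eq_one y hc 0
    have h3 : (c : ℝ) ^ 2 = 1 := by
      have : c ^ 2 = 1 := by rw [← sq_abs, hc]; norm_num
      exact_mod_cast this
    refine (pow_left_inj₀ (norm_nonneg _) (lineNorm_pos y).le two_ne_zero).1 ?_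
    rw [h2, lineNorm_sq]
    push_cast
    linear_combination h3 / 4
  rw [Finset.sum_pair (by decide), hn 1 (by norm_num), hn (-1) (by norm_num)] at h1
  unfold lineAbsSum
  linarith

lemma lineNorm_sampleAngle_le {ℓ m : ℕ} (hm0 : 0 < m) (hm : 6 * m + 2 ≤ ℓ) :
    lineNorm (Real.tan (sampleAngle ℓ m) / 2) ≤ ℓ := by
  have hposR : (0 : ℝ) < ℓ := by exact_mod_cast (by omega : 0 < ℓ)
  have hmR : (6 * m + 2 : ℝ) ≤ ℓ := by exact_mod_cast hm
  have hm0R : (1 : ℝ) ≤ m := by exact_mod_cast hm0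
  have hpi := Real.pi_pos
  have hφ0 : 0 < Real.pi * m / ℓ := by positivity
  have hφ1 : Real.pi * m / ℓ ≤ Real.pi / 2 := by
    rw [div_le_div_iff₀ hposR (by norm_num)]
    nlinarith
  have hsin := Real.mul_le_sin hφ0.le hφ1
  have e : 2 / Real.pi * (Real.pi * m / ℓ) = 2 * m / ℓ := by field_simp
  have hcos : Real.cos (sampleAngle ℓ m) = Real.sin (Real.pi * m / ℓ) := by
    rw [sampleAngle, Real.cos_pi_div_two_sub]
  rw [e, ← hcos] at hsin
  have h2 : 0 < 2 * m / (ℓ : ℝ) := by positivity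
  rw [lineNorm_tan (h2.trans_le hsin)]
  apply inv_le_of_inv_le₀ hposR
  have : (ℓ : ℝ)⁻¹ ≤ 2 * m / ℓ := by
    rw [inv_eq_one_div]; gcongr; linarith
  linarith

/-- The conditions on a large `ℓ` which the sample points high above the corner require. They hold
for `x = ℓ^{-1/3}`: the right hand side is then at least `exp (ℓ^{1/3} / 12)`. -/
lemma exists_high_threshold (C : ℝ) : ∃ L : ℕ, ∀ ℓ : ℕ, L ≤ ℓ →
    ∃ x : ℝ, 0 < x ∧ x ≤ 1 ∧ ℓ * x ^ 3 ≤ 1 ∧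
      C * (ℓ : ℝ) ^ 4 ≤ √(1 + 2 / 3 * x ^ 2) ^ (ℓ - 4) := by
  have h1 := tendsto_exp_mul_div_rpow_atTop 12 (1 / 12) (by norm_num)
  have h2 : Filter.Tendsto (fun n : ℕ => (n : ℝ) ^ (1 / 3 : ℝ)) Filter.atTop Filter.atTop :=
    (tendsto_rpow_atTop (by norm_num)).comp tendsto_natCast_atTop_atTop
  have h3 := (h1.comp h2).eventually_ge_atTop C
  rw [Filter.eventually_atTop] at h3
  obtain ⟨L, hL⟩ := h3
  refine ⟨max L 8, fun ℓ hℓ => ?_⟩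
  have hC := hL ℓ ((le_max_left _ _).trans hℓ)
  have h8 : 8 ≤ ℓ := (le_max_right _ _).trans hℓ
  have h8R : (8 : ℝ) ≤ ℓ := by exact_mod_cast h8
  set w : ℝ := (ℓ : ℝ) ^ (1 / 3 : ℝ) with hw
  have hwpos : 0 < w := Real.rpow_pos_of_pos (by linarith) _
  have hw3 : w ^ 3 = ℓ := by
    rw [hw, ← Real.rpow_natCast, ← Real.rpow_mul (by positivity)]; norm_num
  have hw1 : 1 ≤ w := Real.one_le_rpow (by linarith) (by norm_num)
  refine ⟨w⁻¹, inv_pos.2 hwpos, inv_le_one_of_one_le₀ hw1, ?_, ?_⟩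
  · rw [← hw3]; field_simp; exact le_rfl
  · simp only [Function.comp_apply] at hC
    rw [show (12 : ℝ) = ((12 : ℕ) : ℝ) by norm_num, Real.rpow_natCast,
      le_div_iff₀ (by positivity)] at hC
    have e4 : (ℓ : ℝ) ^ 4 = w ^ 12 := by rw [← hw3]; ring
    rw [e4]
    refine hC.trans ?_
    set u : ℝ := 2 / 3 * (w⁻¹) ^ 2 with hu
    have hu0 : 0 < u := by positivity
    have hu1 : u ≤ 1 := by
      have : (w⁻¹) ^ 2 ≤ 1 := pow_le_one₀ (by positivity) (inv_le_one_of_one_le₀ hw1)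
      linarith
    have hexp : Real.exp (u / 4) ≤ √(1 + u) := by
      apply Real.le_sqrt_of_sq_le
      rw [← Real.exp_nat_mul]
      have := Real.exp_bound_div_one_sub_of_interval' (x := u / 2) (by positivity) (by linarith)
      have e5 : ((2 : ℕ) : ℝ) * (u / 4) = u / 2 := by push_cast; ring
      rw [e5]
      refine this.le.trans ?_
      rw [div_le_iff₀ (by linarith)]
      nlinarith
    calc Real.exp (1 / 12 * w) ≤ Real.exp ((ℓ - 4 : ℕ) * (u / 4)) := by
          apply Real.exp_le_exp.2
          have e6 : (ℓ : ℝ) * (w⁻¹) ^ 2 = w := by rw [← hw3]; field_simp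
          have : (ℓ : ℝ) / 2 ≤ (ℓ - 4 : ℕ) := by
            rw [Nat.cast_sub (by omega)]; push_cast; linarith
          have := mul_le_mul_of_nonneg_right this (show 0 ≤ u / 4 by positivity)
          rw [hu] at this ⊢
          linarith
      _ = Real.exp (u / 4) ^ (ℓ - 4) := by rw [← Real.exp_nat_mul]
      _ ≤ _ := by gcongr

/-- The sign of `Δ` at the sample points with `|z|² ≥ 8`. -/
lemma lineDelta_sampleAngle_high : ∃ L : ℕ, ∀ h ℓ m p : ℕ, L ≤ ℓ → ℓ = 2 * h → 0 < m →
    6 * m + 2 ≤ ℓ → Even p → 8 ≤ lineNorm (Real.tan (sampleAngle ℓ m) / 2) ^ 2 →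
    0 < (-1) ^ (h + m) * lineDelta (ℓ + p) ℓ (Real.tan (sampleAngle ℓ m) / 2) := by
  obtain ⟨L, hL⟩ := exists_high_threshold (8 * (latticeConst + 1))
  refine ⟨max L 8, fun h ℓ m p hLℓ hℓ hm0 hm ep h8 => ?_⟩
  obtain ⟨x, hx0, hx1, hx3, hx⟩ := hL ℓ ((le_max_left _ _).trans hLℓ)
  have h8ℓ : 8 ≤ ℓ := (le_max_right _ _).trans hLℓ
  have h4 : 4 ≤ ℓ := by omega
  have hpt := sign_mul_re_lineTerm_ge hℓ h4 hm0 hm hx0 hx1 hx3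
  have hrle := lineNorm_sampleAngle_le hm0 hm
  have hposR : (0 : ℝ) < ℓ := by exact_mod_cast (by omega : 0 < ℓ)
  have hmR : (6 * m + 2 : ℝ) ≤ ℓ := by exact_mod_cast hm
  have hm0R : (0 : ℝ) < m := by exact_mod_cast hm0
  have hy : √3 / 2 ≤ Real.tan (sampleAngle ℓ m) / 2 := by
    have hpi := Real.pi_pos
    refine tan_pi_div_three_le ?_ ?_
    · rw [sampleAngle_eq]
      have : Real.pi * m / ℓ ≤ Real.pi / 6 := by
        rw [div_le_div_iff₀ hposR (by norm_num)]
        nlinarith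
      linarith
    · have : 0 < Real.pi * m / ℓ := by positivity
      unfold sampleAngle
      linarith
  set y := Real.tan (sampleAngle ℓ m) / 2
  set σ : ℝ := (-1) ^ (h + m) with hσ
  have hσ1 : |σ| = 1 := by rw [hσ, abs_pow, abs_neg, abs_one, one_pow]
  set κ := √(1 + 2 / 3 * x ^ 2)
  have hκ : 0 < κ := Real.sqrt_pos.2 (by positivity)
  set r := lineNorm y
  have hr : 0 < r := lineNorm_pos y
  have hC := latticeConst_nonneg
  set T := lineAbsSum y ℓ with hT
  have hTr : (r ^ ℓ)⁻¹ ≤ T := inv_lineNorm_pow_le hy h4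
  have hTpos : 0 < T := (by positivity : 0 < (r ^ ℓ)⁻¹).trans_le hTr
  -- the terms whose sign is not controlled contribute at most an eighth of the absolute sum
  have hsmall : ((κ * r) ^ (ℓ - 4))⁻¹ * latticeConst ≤ T / 8 := by
    have e : ((κ * r) ^ (ℓ - 4))⁻¹ = (κ ^ (ℓ - 4))⁻¹ * r ^ 4 * (r ^ ℓ)⁻¹ := by
      rw [show r ^ ℓ = r ^ 4 * r ^ (ℓ - 4) by rw [← pow_add]; congr 1; omega, mul_pow]
      field_simp
    have h1 : r ^ 4 ≤ (ℓ : ℝ) ^ 4 := by gcongr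
    have h2 : (κ ^ (ℓ - 4))⁻¹ * r ^ 4 * latticeConst ≤ 1 / 8 := by
      rw [mul_assoc, inv_mul_le_iff₀ (by positivity)]
      have : r ^ 4 * latticeConst ≤ (ℓ : ℝ) ^ 4 * latticeConst := by gcongr
      nlinarith [pow_pos hposR 4]
    calc ((κ * r) ^ (ℓ - 4))⁻¹ * latticeConst
        = ((κ ^ (ℓ - 4))⁻¹ * r ^ 4 * latticeConst) * (r ^ ℓ)⁻¹ := by rw [e]; ring
      _ ≤ 1 / 8 * T := by gcongr
      _ = T / 8 := by ring
  have hmain : 3 / 8 * T ≤ σ * lineTail y ℓ := by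
    have s1 := (summable_norm_lineTerm hy h4).mul_left (1 / 2)
    have s2 := ((summable_norm_lineTerm_four hy).mul_left ((κ * r) ^ (ℓ - 4))⁻¹).mul_left 2
    have s3 := (summable_re_lineTerm hy h4).mul_left σ
    have := (s1.sub s2).tsum_le_tsum hpt s3
    rw [s1.tsum_sub s2, tsum_mul_left, tsum_mul_left, tsum_mul_left, tsum_mul_left] at this
    have h5 : ((κ * r) ^ (ℓ - 4))⁻¹ * ∑' v, ‖lineTerm y 4 v‖
        ≤ ((κ * r) ^ (ℓ - 4))⁻¹ * latticeConst := by
      gcongr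
      exact tsum_norm_lineTerm_four_le hy
    have e1 : T = 1 / 2 * ∑' v, ‖lineTerm y ℓ v‖ := rfl
    have e2 : σ * lineTail y ℓ = 1 / 2 * (σ * ∑' v, (lineTerm y ℓ v).re) := by
      unfold lineTail; ring
    rw [e2]
    linarith
  have hinv : ∀ n : ℕ, 2 ≤ n → (r ^ n)⁻¹ ≤ 1 / 8 := by
    intro n hn
    rw [← one_div]
    apply one_div_le_one_div_of_le (by norm_num)
    exact h8.trans (pow_le_pow_right₀ (one_le_lineNorm hy) hn)
  have htail : ∀ n : ℕ, ℓ + 2 ≤ n → |lineTail y n| ≤ T / 8 := by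
    intro n hn
    have h1 := abs_lineTail_le hy (n := n) (by omega)
    have h2 := lineAbsSum_le hy h4 (n := n) (by omega)
    have h3 := hinv (n - ℓ) (by omega)
    have := mul_le_mul_of_nonneg_right h3 hTpos.le
    linarith
  have hT8 : T ≤ 1 / 8 := by
    have h1 := lineAbsSum_le hy le_rfl h4
    have h2 := lineAbsSum_four_le hy
    have h3 : (r ^ (ℓ - 4))⁻¹ * latticeConst ≤ 1 / 8 := by
      rw [inv_mul_le_iff₀ (by positivity)]
      have hκr : κ ≤ r := by
        refine (Real.sqrt_le_sqrt (show 1 + 2 / 3 * x ^ 2 ≤ r ^ 2 from ?_)).trans_eq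
          (Real.sqrt_sq hr.le)
        have : x ^ 2 ≤ 1 := pow_le_one₀ hx0.le hx1
        linarith
      have h6 : κ ^ (ℓ - 4) ≤ r ^ (ℓ - 4) := by gcongr
      have h7 : (1 : ℝ) ≤ (ℓ : ℝ) ^ 4 := one_le_pow₀ (by exact_mod_cast (by omega : 1 ≤ ℓ))
      nlinarith
    have h4' := mul_le_mul_of_nonneg_left h2 (show 0 ≤ (r ^ (ℓ - 4))⁻¹ by positivity)
    linarith
  have hk : ∀ b : ℝ, -|b| ≤ σ * b := by
    intro b
    have := neg_abs_le (σ * b)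
    rwa [abs_mul, hσ1, one_mul] at this
  have hle := abs_lineTail_le hy h4
  change |lineTail y ℓ| ≤ T at hle
  have t3 := htail (ℓ + p + ℓ) (by omega)
  have b3 := hk (-lineTail y (ℓ + p + ℓ))
  rw [abs_neg] at b3
  unfold lineDelta
  by_cases hp : p = 0
  · subst hp
    rw [add_zero] at *
    have b2 := hk (lineTail y ℓ * lineTail y ℓ)
    rw [abs_mul] at b2
    have : |lineTail y ℓ| * |lineTail y ℓ| ≤ 1 / 8 * T :=
      mul_le_mul (hle.trans hT8) hle (abs_nonneg _) (by norm_num)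
    nlinarith
  · have hp2 : 2 ≤ p := by
      have := Nat.even_iff.1 ep
      omega
    have t1 := htail (ℓ + p) (by omega)
    have b1 := hk (lineTail y (ℓ + p))
    have b2 := hk (lineTail y (ℓ + p) * lineTail y ℓ)
    rw [abs_mul] at b2
    have : |lineTail y (ℓ + p)| * |lineTail y ℓ| ≤ T / 8 * (1 / 8) :=
      mul_le_mul t1 (hle.trans hT8) (abs_nonneg _) (by positivity)
    nlinarith

/-! ### Taylor expansion of the main term at the corner -/

/-- The expansion `-log (2 cos (π/3 + ψ)) = √3 ψ + 2ψ² + O(ψ³)`. -/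
lemma abs_log_two_cos_add_le {ψ : ℝ} (h0 : 0 ≤ ψ) (h1 : ψ ≤ 1 / 100) :
    |-Real.log (2 * Real.cos (Real.pi / 3 + ψ)) - (√3 * ψ + 2 * ψ ^ 2)| ≤ 20 * ψ ^ 3 := by
  set s := √3
  have hs2 : s ^ 2 = 3 := Real.sq_sqrt (by norm_num)
  have hs0 : 0 ≤ s := Real.sqrt_nonneg 3
  have hs1 : s ≤ 1.8 := by nlinarith
  have habs : |ψ| ≤ 1 := by rw [abs_of_nonneg h0]; linarith
  have hc := Real.cos_bound habs
  have hsn := Real.sin_bound habs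
  rw [abs_of_nonneg h0] at hc hsn
  set x := 1 - (Real.cos ψ - s * Real.sin ψ) with hx
  have p2 : 0 ≤ ψ ^ 2 := by positivity
  have p3 : 0 ≤ ψ ^ 3 := by positivity
  have p4 : ψ ^ 4 ≤ ψ ^ 3 / 100 := by nlinarith
  have p5 : ψ ^ 5 ≤ ψ ^ 3 / 100 := by nlinarith
  have p3' : ψ ^ 3 ≤ ψ ^ 2 / 100 := by nlinarith
  have p2' : ψ ^ 2 ≤ ψ / 100 := by nlinarith
  rw [abs_le] at hc hsn
  have hxa : |x - (s * ψ + ψ ^ 2 / 2)| ≤ ψ ^ 3 := by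
    rw [abs_le]
    have b1 : s * (Real.sin ψ - (ψ - ψ ^ 3 / 6)) ≤ 1.8 * (ψ ^ 5 / 100) := by
      have : s * (Real.sin ψ - (ψ - ψ ^ 3 / 6)) ≤ s * (ψ ^ 5 / 100) := by
        apply mul_le_mul_of_nonneg_left hsn.2 hs0
      nlinarith [pow_nonneg h0 5]
    have b2 : -(1.8 * (ψ ^ 5 / 100)) ≤ s * (Real.sin ψ - (ψ - ψ ^ 3 / 6)) := by
      have : s * (-(ψ ^ 5 / 100)) ≤ s * (Real.sin ψ - (ψ - ψ ^ 3 / 6)) := by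
        apply mul_le_mul_of_nonneg_left hsn.1 hs0
      nlinarith [pow_nonneg h0 5]
    have b3 : s * ψ ^ 3 ≤ 1.8 * ψ ^ 3 := by gcongr
    have b4 : 0 ≤ s * ψ ^ 3 := by positivity
    constructor <;> rw [hx] <;> linarith [hc.1, hc.2]
  rw [abs_le] at hxa
  have hx0 : 0 ≤ x := by nlinarith
  have hx2 : x ≤ 2 * ψ := by nlinarith
  have hlog := Real.abs_log_sub_add_sum_range_le (x := x) (by rw [abs_of_nonneg hx0]; linarith) 2
  rw [Finset.sum_range_succ, Finset.sum_range_one, abs_of_nonneg hx0] at hlog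
  have hlog2 : |x + x ^ 2 / 2 + Real.log (1 - x)| ≤ 10 * ψ ^ 3 := by
    norm_num at hlog
    refine hlog.trans ?_
    rw [div_le_iff₀ (by linarith)]
    have : x ^ 3 ≤ (2 * ψ) ^ 3 := by gcongr
    nlinarith
  have e1 : 1 - x = 2 * Real.cos (Real.pi / 3 + ψ) := by rw [two_cos_add_eq, hx]; ring
  rw [← e1]
  have hsq : |x ^ 2 - 3 * ψ ^ 2| ≤ 8 * ψ ^ 3 := by
    have hd : |x - s * ψ| ≤ 0.6 * ψ ^ 2 := by
      rw [abs_le]; constructor <;> linarith [hxa.1, hxa.2]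
    have hsum : |x + s * ψ| ≤ 4 * ψ := by
      rw [abs_of_nonneg (by positivity)]; nlinarith
    have e2 : x ^ 2 - 3 * ψ ^ 2 = (x - s * ψ) * (x + s * ψ) := by
      linear_combination (ψ ^ 2) * hs2
    rw [e2, abs_mul]
    have := mul_le_mul hd hsum (abs_nonneg _) (by positivity)
    nlinarith
  rw [abs_le] at hlog2 hsq ⊢
  constructor <;> linarith [hlog2.1, hlog2.2, hsq.1, hsq.2, hxa.1, hxa.2]

/-- The second-order Taylor polynomial at `ψ = 0` of `(2 cos (π/3 + ψ))^X cos (c + Yψ)`. -/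
noncomputable def cornerTaylor (c X Y ψ : ℝ) : ℝ :=
  Real.cos c * (1 - √3 * X * ψ - 2 * X * ψ ^ 2 + (3 * X ^ 2 - Y ^ 2) * ψ ^ 2 / 2)
    - Real.sin c * (Y * ψ - √3 * X * Y * ψ ^ 2)

/-- The second-order expansion of `Re (e^{ic} exp (u + iw))`. -/
lemma abs_exp_mul_cos_sub_le {c u w : ℝ} (h : |u| + |w| ≤ 1) :
    |Real.exp u * Real.cos (c + w)
      - (Real.cos c * (1 + u + (u ^ 2 - w ^ 2) / 2) - Real.sin c * (w + u * w))|
      ≤ (|u| + |w|) ^ 3 := by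
  set ζ : ℂ := ⟨u, w⟩ with hζ
  have hn : ‖ζ‖ ≤ |u| + |w| := Complex.norm_le_abs_re_add_abs_im ζ
  have hb := Complex.exp_bound (hn.trans h) (n := 3) (by norm_num)
  have hsum : ∑ m ∈ Finset.range 3, ζ ^ m / (m.factorial : ℂ) = 1 + ζ + ζ ^ 2 / 2 := by
    simp [Finset.sum_range_succ, Nat.factorial]
  rw [hsum] at hb
  have hrot : ‖Complex.exp (c * Complex.I)‖ = 1 := Complex.norm_exp_ofReal_mul_I c
  have e : Real.exp u * Real.cos (c + w)
      - (Real.cos c * (1 + u + (u ^ 2 - w ^ 2) / 2) - Real.sin c * (w + u * w))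
      = (Complex.exp (c * Complex.I) * (Complex.exp ζ - (1 + ζ + ζ ^ 2 / 2))).re := by
    rw [Complex.mul_re, Complex.exp_ofReal_mul_I_re, Complex.exp_ofReal_mul_I_im,
      Complex.sub_re, Complex.sub_im, Complex.exp_re, Complex.exp_im]
    have r1 : (1 + ζ + ζ ^ 2 / 2).re = 1 + u + (u ^ 2 - w ^ 2) / 2 := by
      simp [hζ, pow_two]
    have r2 : (1 + ζ + ζ ^ 2 / 2).im = w + u * w := by
      simp [hζ, pow_two]; ring
    rw [r1, r2, Real.cos_add]
    simp only [hζ]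
    ring
  rw [e]
  refine (Complex.abs_re_le_norm _).trans ?_
  rw [norm_mul, hrot, one_mul]
  refine hb.trans ?_
  have h3 : ‖ζ‖ ^ 3 ≤ (|u| + |w|) ^ 3 := by gcongr
  have h4 : 0 ≤ ‖ζ‖ ^ 3 := by positivity
  norm_num [Nat.factorial]
  linarith

lemma abs_sub_cornerTaylor_le {ψ N X Y : ℝ} (c : ℝ) (h0 : 0 ≤ ψ) (h1 : ψ ≤ 1 / 100) (hN : 1 ≤ N)
    (hX0 : 0 ≤ X) (hY0 : 0 ≤ Y) (hX : X ≤ N) (hY : Y ≤ N) (hNψ : 3 * (N * ψ) ≤ 1) :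
    |Real.exp (X * Real.log (2 * Real.cos (Real.pi / 3 + ψ))) * Real.cos (c + Y * ψ)
      - cornerTaylor c X Y ψ| ≤ 60 * (N ^ 3 * ψ ^ 3) := by
  have hα := abs_log_two_cos_add_le h0 h1
  set α := -Real.log (2 * Real.cos (Real.pi / 3 + ψ)) with hαdef
  have hlog : X * Real.log (2 * Real.cos (Real.pi / 3 + ψ)) = -(X * α) := by rw [hαdef]; ring
  rw [hlog]
  set s := √3 with hs
  have hs2 : s ^ 2 = 3 := Real.sq_sqrt (by norm_num)
  have hs0 : 0 ≤ s := Real.sqrt_nonneg 3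
  have hs1 : s ≤ 1.8 := by nlinarith
  have p2 : 0 ≤ ψ ^ 2 := by positivity
  have p3 : 0 ≤ ψ ^ 3 := by positivity
  have p3' : ψ ^ 3 ≤ ψ ^ 2 / 100 := by nlinarith
  have p2' : ψ ^ 2 ≤ ψ / 100 := by nlinarith
  have hα' := abs_le.1 hα
  have hα0 : 0 ≤ α := by nlinarith [mul_nonneg hs0 h0, hα'.1]
  have hα2 : α ≤ 2 * ψ := by nlinarith [hα'.2]
  have hd : |α - s * ψ| ≤ 3 * ψ ^ 2 := by
    rw [abs_le]; constructor <;> linarith [hα'.1, hα'.2]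
  have hsq : |α ^ 2 - 3 * ψ ^ 2| ≤ 12 * ψ ^ 3 := by
    have e2 : α ^ 2 - 3 * ψ ^ 2 = (α - s * ψ) * (α + s * ψ) := by
      linear_combination (ψ ^ 2) * hs2
    have hsum : |α + s * ψ| ≤ 4 * ψ := by
      rw [abs_of_nonneg (by positivity)]; nlinarith
    rw [e2, abs_mul]
    have := mul_le_mul hd hsum (abs_nonneg _) (by positivity)
    nlinarith
  have hN0 : 0 ≤ N := by linarith
  have hXα : X * α ≤ 2 * (N * ψ) := by
    have := mul_le_mul hX hα2 hα0 hN0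
    linarith
  have hYψ : Y * ψ ≤ N * ψ := by gcongr
  have hXα0 : 0 ≤ X * α := by positivity
  have hYψ0 : 0 ≤ Y * ψ := by positivity
  have habs : |-(X * α)| + |Y * ψ| ≤ 3 * (N * ψ) := by
    rw [abs_neg, abs_of_nonneg hXα0, abs_of_nonneg hYψ0]; linarith
  have hT := abs_exp_mul_cos_sub_le (c := c) (habs.trans hNψ)
  have hT' : (|-(X * α)| + |Y * ψ|) ^ 3 ≤ 27 * (N ^ 3 * ψ ^ 3) := by
    calc _ ≤ (3 * (N * ψ)) ^ 3 := by gcongr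
      _ = _ := by ring
  set E1 := α - (s * ψ + 2 * ψ ^ 2) with hE1
  set E2 := α ^ 2 - 3 * ψ ^ 2 with hE2
  set E3 := α - s * ψ with hE3
  have hid : (Real.cos c * (1 + -(X * α) + ((-(X * α)) ^ 2 - (Y * ψ) ^ 2) / 2)
      - Real.sin c * (Y * ψ + -(X * α) * (Y * ψ))) - cornerTaylor c X Y ψ
      = Real.cos c * (-(X * E1) + X ^ 2 * E2 / 2) + Real.sin c * (X * Y * ψ * E3) := by
    unfold cornerTaylor
    rw [hE1, hE2, hE3, ← hs]
    ring
  have hNN : N ≤ N ^ 3 := le_self_pow₀ hN (by norm_num)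
  have hNN2 : N ^ 2 ≤ N ^ 3 := pow_le_pow_right₀ hN (by norm_num)
  have q1 : |X * E1| ≤ 20 * (N ^ 3 * ψ ^ 3) := by
    rw [abs_mul, abs_of_nonneg hX0]
    have := mul_le_mul (hX.trans hNN) hα (abs_nonneg _) (by positivity)
    linarith
  have q2 : |X ^ 2 * E2 / 2| ≤ 6 * (N ^ 3 * ψ ^ 3) := by
    rw [abs_div, abs_mul, abs_of_nonneg (sq_nonneg X), abs_two]
    have hX2 : X ^ 2 ≤ N ^ 2 := by gcongr
    have := mul_le_mul (hX2.trans hNN2) hsq (abs_nonneg _) (by positivity)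
    linarith
  have q3 : |X * Y * ψ * E3| ≤ 3 * (N ^ 3 * ψ ^ 3) := by
    rw [abs_mul, abs_of_nonneg (by positivity)]
    have hXY : X * Y ≤ N ^ 3 := by
      have := mul_le_mul hX hY hY0 hN0
      nlinarith
    have h5 : X * Y * ψ ≤ N ^ 3 * ψ := by gcongr
    have := mul_le_mul h5 hd (abs_nonneg _) (by positivity)
    linarith
  have r1 : |Real.cos c * (-(X * E1) + X ^ 2 * E2 / 2)| ≤ 26 * (N ^ 3 * ψ ^ 3) := by
    rw [abs_mul]
    have h6 : |-(X * E1) + X ^ 2 * E2 / 2| ≤ 26 * (N ^ 3 * ψ ^ 3) := by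
      refine (abs_add_le _ _).trans ?_
      rw [abs_neg]; linarith
    have := mul_le_mul (Real.abs_cos_le_one c) h6 (abs_nonneg _) zero_le_one
    linarith
  have r2 : |Real.sin c * (X * Y * ψ * E3)| ≤ 3 * (N ^ 3 * ψ ^ 3) := by
    rw [abs_mul]
    have := mul_le_mul (Real.abs_sin_le_one c) q3 (abs_nonneg _) zero_le_one
    linarith
  have hT2 := abs_le.1 (hT.trans hT')
  have r1' := abs_le.1 r1
  have r2' := abs_le.1 r2
  rw [abs_le]
  constructor <;> linarith [hT2.1, hT2.2, r1'.1, r1'.2, r2'.1, r2'.2]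

/-- The second-order expansion of the main term at the corner; `i`, `i'` and `i''` are the residues
of `ℓ`, `ℓ + p` and `p` modulo `6`. -/
lemma abs_mainTerm_sub_le {ℓ p i i' i'' : ℕ} {ψ : ℝ} (hi : ℓ % 6 = i) (hi' : (ℓ + p) % 6 = i')
    (hi'' : p % 6 = i'') (hℓ : 0 < ℓ) (h0 : 0 ≤ ψ) (h1 : ψ ≤ 1 / 100)
    (hkψ : 3 * ((ℓ + p : ℝ) * ψ) ≤ 1) :
    |mainTerm ℓ p (Real.pi / 3 + ψ)
      - (cornerTaylor (i * (Real.pi / 3)) 0 ℓ ψ + cornerTaylor (i' * (Real.pi / 3)) p (ℓ + p) ψ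
        + cornerTaylor (i'' * (Real.pi / 3)) (ℓ + p) p ψ)| ≤ 180 * ((ℓ + p : ℝ) ^ 3 * ψ ^ 3) := by
  have hN : (1 : ℝ) ≤ ℓ + p := by exact_mod_cast (by omega : 1 ≤ ℓ + p)
  have hℓ0 : (0 : ℝ) ≤ ℓ := by positivity
  have hp0 : (0 : ℝ) ≤ p := by positivity
  have hpi := Real.pi_gt_three
  have hapos : 0 < 2 * Real.cos (Real.pi / 3 + ψ) := by
    have := cos_pos_of_lt (θ := Real.pi / 3 + ψ) (by linarith) (by linarith)
    linarith
  have hpow : ∀ n : ℕ, Real.exp (n * Real.log (2 * Real.cos (Real.pi / 3 + ψ)))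
      = (2 * Real.cos (Real.pi / 3 + ψ)) ^ n := by
    intro n
    rw [Real.exp_nat_mul, Real.exp_log hapos]
  have t1 := abs_sub_cornerTaylor_le (X := 0) (Y := ℓ) (i * (Real.pi / 3)) h0 h1 hN le_rfl hℓ0
    (by positivity) (by linarith) hkψ
  have t2 := abs_sub_cornerTaylor_le (X := p) (Y := ℓ + p) (i' * (Real.pi / 3)) h0 h1 hN hp0
    (by positivity) (by linarith) le_rfl hkψ
  have t3 := abs_sub_cornerTaylor_le (X := ℓ + p) (Y := p) (i'' * (Real.pi / 3)) h0 h1 hN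
    (by positivity) hp0 le_rfl (by linarith) hkψ
  rw [zero_mul, Real.exp_zero, one_mul, ← cos_nat_mul_add (s := ℓ / 6) (by omega)] at t1
  rw [hpow] at t2
  have e2 := cos_nat_mul_add (p := ℓ + p) (i := i') (s := (ℓ + p) / 6) (by omega) ψ
  have e3 := cos_nat_mul_add (p := p) (i := i'') (s := p / 6) (by omega) ψ
  have e4 := hpow (ℓ + p)
  push_cast at e2 e4
  rw [← e2] at t2
  rw [← e3, e4] at t3
  unfold mainTerm
  push_cast
  rw [abs_le] at t1 t2 t3 ⊢
  constructor <;> linarith [t1.1, t1.2, t2.1, t2.2, t3.1, t3.2]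

lemma cornerTaylor_zero (X Y ψ : ℝ) : cornerTaylor ((0 : ℕ) * (Real.pi / 3)) X Y ψ
    = 1 - √3 * X * ψ - 2 * X * ψ ^ 2 + (3 * X ^ 2 - Y ^ 2) * ψ ^ 2 / 2 := by
  simp [cornerTaylor]

lemma cornerTaylor_two (X Y ψ : ℝ) : cornerTaylor ((2 : ℕ) * (Real.pi / 3)) X Y ψ
    = -(1 / 2) * (1 - √3 * X * ψ - 2 * X * ψ ^ 2 + (3 * X ^ 2 - Y ^ 2) * ψ ^ 2 / 2)
      - √3 / 2 * (Y * ψ - √3 * X * Y * ψ ^ 2) := by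
  have e : ((2 : ℕ) : ℝ) * (Real.pi / 3) = Real.pi - Real.pi / 3 := by push_cast; ring
  rw [cornerTaylor, e, Real.cos_pi_sub, Real.sin_pi_sub, Real.cos_pi_div_three,
    Real.sin_pi_div_three]

lemma cornerTaylor_four (X Y ψ : ℝ) : cornerTaylor ((4 : ℕ) * (Real.pi / 3)) X Y ψ
    = -(1 / 2) * (1 - √3 * X * ψ - 2 * X * ψ ^ 2 + (3 * X ^ 2 - Y ^ 2) * ψ ^ 2 / 2)
      + √3 / 2 * (Y * ψ - √3 * X * Y * ψ ^ 2) := by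
  have e : ((4 : ℕ) : ℝ) * (Real.pi / 3) = Real.pi / 3 + Real.pi := by push_cast; ring
  rw [cornerTaylor, e, Real.cos_add_pi, Real.sin_add_pi, Real.cos_pi_div_three,
    Real.sin_pi_div_three]
  ring

section Corner

variable {ℓ p : ℕ} {ψ : ℝ}

/-- Consequences of `(ℓ+p)³ ψ` being small; the fourth makes the error of the Taylor expansion
smaller than half of `ψ²`. -/
lemma corner_smallness (hℓ : 0 < ℓ) (h0 : 0 < ψ) (hk : 360 * ((ℓ + p : ℝ) ^ 3 * ψ) ≤ 1) :
    (1 : ℝ) ≤ ℓ + p ∧ 360 * ((ℓ + p : ℝ) * ψ) ≤ 1 ∧ 360 * ((ℓ + p : ℝ) ^ 2 * ψ) ≤ 1 ∧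
      180 * ((ℓ + p : ℝ) ^ 3 * ψ ^ 3) ≤ ψ ^ 2 / 2 ∧ ψ ≤ 1 / 100 := by
  have hN : (1 : ℝ) ≤ ℓ + p := by exact_mod_cast (by omega : 1 ≤ ℓ + p)
  have h13 : (ℓ + p : ℝ) ≤ (ℓ + p : ℝ) ^ 3 := le_self_pow₀ hN (by norm_num)
  have h23 : (ℓ + p : ℝ) ^ 2 ≤ (ℓ + p : ℝ) ^ 3 := pow_le_pow_right₀ hN (by norm_num)
  have a1 := mul_le_mul_of_nonneg_right h13 h0.le
  have a2 := mul_le_mul_of_nonneg_right h23 h0.le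
  have a3 := mul_le_mul_of_nonneg_right hk (sq_nonneg ψ)
  have a4 := mul_le_mul_of_nonneg_right hN h0.le
  refine ⟨hN, by linarith, by linarith, ?_, by linarith⟩
  nlinarith

/-- For `ℓ ≡ 0`, `p ≡ 4` the main term is `√3 (ℓ + 2p) ψ` to first order. -/
lemma mainTerm_zero_four (hℓ : ℓ % 6 = 0) (hp : p % 6 = 4) (hpos : 0 < ℓ) (h0 : 0 < ψ)
    (hk : 360 * ((ℓ + p : ℝ) ^ 3 * ψ) ≤ 1) :
    ψ ^ 2 / 2 ≤ mainTerm ℓ p (Real.pi / 3 + ψ) := by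
  obtain ⟨hN, hNψ, hN2, herr, hψ⟩ := corner_smallness hpos h0 hk
  have h := abs_mainTerm_sub_le hℓ (show (ℓ + p) % 6 = 4 by omega) hp hpos h0.le hψ (by linarith)
  rw [cornerTaylor_zero, cornerTaylor_four, cornerTaylor_four] at h
  have hs2 : (√3) ^ 2 = 3 := Real.sq_sqrt (by norm_num)
  have hs0 : 0 ≤ √3 := Real.sqrt_nonneg 3
  have hs1 : 1 ≤ √3 := by nlinarith
  have hℓ0 : (0 : ℝ) ≤ ℓ := by positivity
  have hp0 : (0 : ℝ) ≤ p := by positivity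
  set l : ℝ := (ℓ : ℝ)
  set q : ℝ := (p : ℝ)
  have e : 1 - √3 * 0 * ψ - 2 * 0 * ψ ^ 2 + (3 * 0 ^ 2 - l ^ 2) * ψ ^ 2 / 2
      + (-(1 / 2) * (1 - √3 * q * ψ - 2 * q * ψ ^ 2 + (3 * q ^ 2 - (l + q) ^ 2) * ψ ^ 2 / 2)
        + √3 / 2 * ((l + q) * ψ - √3 * q * (l + q) * ψ ^ 2))
      + (-(1 / 2) * (1 - √3 * (l + q) * ψ - 2 * (l + q) * ψ ^ 2
          + (3 * (l + q) ^ 2 - q ^ 2) * ψ ^ 2 / 2)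
        + √3 / 2 * (q * ψ - √3 * (l + q) * q * ψ ^ 2))
      = √3 * ((l + 2 * q) * ψ) + (l + 2 * q - (l ^ 2 + 4 * l * q + 4 * q ^ 2)) * ψ ^ 2 := by
    linear_combination (-(q * (l + q)) * ψ ^ 2) * hs2
  rw [e, abs_le] at h
  have b1 : (l + q) * ψ ≤ √3 * ((l + 2 * q) * ψ) := by
    have : (l + q) * ψ ≤ (l + 2 * q) * ψ := by gcongr; linarith
    have h2 : 0 ≤ (l + 2 * q) * ψ := by positivity
    nlinarith
  have b2 : -(4 * ((l + q) ^ 2 * ψ)) * ψ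
      ≤ (l + 2 * q - (l ^ 2 + 4 * l * q + 4 * q ^ 2)) * ψ ^ 2 := by
    have : -4 * (l + q) ^ 2 ≤ l + 2 * q - (l ^ 2 + 4 * l * q + 4 * q ^ 2) := by
      nlinarith [mul_nonneg hℓ0 hp0]
    nlinarith [mul_le_mul_of_nonneg_right this (sq_nonneg ψ)]
  have b3 : ψ ≤ (l + q) * ψ := le_mul_of_one_le_left h0.le hN
  nlinarith [h.1]

/-- For `ℓ ≡ 0`, `p ≡ 2` the constant and linear terms cancel, and `hQ` bounds the coefficient of
`ψ²` from below. -/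
lemma mainTerm_zero_two (hℓ : ℓ % 6 = 0) (hp : p % 6 = 2) (hpos : 0 < ℓ) (h0 : 0 < ψ)
    (hk : 360 * ((ℓ + p : ℝ) ^ 3 * ψ) ≤ 1)
    (hQ : (1 : ℝ) ≤ 2 * (ℓ + p) * p - ℓ ^ 2 + ℓ + 2 * p) :
    ψ ^ 2 / 2 ≤ mainTerm ℓ p (Real.pi / 3 + ψ) := by
  obtain ⟨hN, hNψ, hN2, herr, hψ⟩ := corner_smallness hpos h0 hk
  have h := abs_mainTerm_sub_le hℓ (show (ℓ + p) % 6 = 2 by omega) hp hpos h0.le hψ (by linarith)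
  rw [cornerTaylor_zero, cornerTaylor_two, cornerTaylor_two] at h
  have hs2 : (√3) ^ 2 = 3 := Real.sq_sqrt (by norm_num)
  set l : ℝ := (ℓ : ℝ)
  set q : ℝ := (p : ℝ)
  have e : 1 - √3 * 0 * ψ - 2 * 0 * ψ ^ 2 + (3 * 0 ^ 2 - l ^ 2) * ψ ^ 2 / 2
      + (-(1 / 2) * (1 - √3 * q * ψ - 2 * q * ψ ^ 2 + (3 * q ^ 2 - (l + q) ^ 2) * ψ ^ 2 / 2)
        - √3 / 2 * ((l + q) * ψ - √3 * q * (l + q) * ψ ^ 2))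
      + (-(1 / 2) * (1 - √3 * (l + q) * ψ - 2 * (l + q) * ψ ^ 2
          + (3 * (l + q) ^ 2 - q ^ 2) * ψ ^ 2 / 2)
        - √3 / 2 * (q * ψ - √3 * (l + q) * q * ψ ^ 2))
      = (2 * (l + q) * q - l ^ 2 + l + 2 * q) * ψ ^ 2 := by
    linear_combination (q * (l + q) * ψ ^ 2) * hs2
  rw [e, abs_le] at h
  nlinarith [h.1, mul_le_mul_of_nonneg_right hQ (sq_nonneg ψ)]

/-- For `ℓ ≡ 4`, `p ≡ 2` the main term is `-√3 (p - ℓ) ψ` to first order. -/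
lemma mainTerm_four_two (hℓ : ℓ % 6 = 4) (hp : p % 6 = 2) (hpos : 0 < ℓ) (h0 : 0 < ψ)
    (hk : 360 * ((ℓ + p : ℝ) ^ 3 * ψ) ≤ 1) (hQ : (1 : ℝ) ≤ p - ℓ) :
    ψ ^ 2 / 2 ≤ -mainTerm ℓ p (Real.pi / 3 + ψ) := by
  obtain ⟨hN, hNψ, hN2, herr, hψ⟩ := corner_smallness hpos h0 hk
  have h := abs_mainTerm_sub_le hℓ (show (ℓ + p) % 6 = 0 by omega) hp hpos h0.le hψ (by linarith)
  rw [cornerTaylor_zero, cornerTaylor_four, cornerTaylor_two] at h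
  have hs2 : (√3) ^ 2 = 3 := Real.sq_sqrt (by norm_num)
  have hs0 : 0 ≤ √3 := Real.sqrt_nonneg 3
  have hs1 : 1 ≤ √3 := by nlinarith
  have hℓ0 : (0 : ℝ) ≤ ℓ := by positivity
  have hp0 : (0 : ℝ) ≤ p := by positivity
  set l : ℝ := (ℓ : ℝ)
  set q : ℝ := (p : ℝ)
  have e : -(1 / 2) * (1 - √3 * 0 * ψ - 2 * 0 * ψ ^ 2 + (3 * 0 ^ 2 - l ^ 2) * ψ ^ 2 / 2)
        + √3 / 2 * (l * ψ - √3 * 0 * l * ψ ^ 2)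
      + (1 - √3 * q * ψ - 2 * q * ψ ^ 2 + (3 * q ^ 2 - (l + q) ^ 2) * ψ ^ 2 / 2)
      + (-(1 / 2) * (1 - √3 * (l + q) * ψ - 2 * (l + q) * ψ ^ 2
          + (3 * (l + q) ^ 2 - q ^ 2) * ψ ^ 2 / 2)
        - √3 / 2 * (q * ψ - √3 * (l + q) * q * ψ ^ 2))
      = -(√3 * ((q - l) * ψ)) + (l - q - l ^ 2 - l * q + 2 * q ^ 2) * ψ ^ 2 := by
    linear_combination ((l + q) * q * ψ ^ 2 / 2) * hs2
  rw [e, abs_le] at h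
  have b1 : ψ ≤ √3 * ((q - l) * ψ) := by
    have : ψ ≤ (q - l) * ψ := le_mul_of_one_le_left h0.le hQ
    nlinarith
  have b2 : (l - q - l ^ 2 - l * q + 2 * q ^ 2) * ψ ^ 2 ≤ (2 * ((l + q) ^ 2 * ψ)) * ψ := by
    have : l - q - l ^ 2 - l * q + 2 * q ^ 2 ≤ 2 * (l + q) ^ 2 := by
      nlinarith [mul_nonneg hℓ0 hp0]
    nlinarith [mul_le_mul_of_nonneg_right this (sq_nonneg ψ)]
  nlinarith [h.2]

/-- For `ℓ ≡ 4`, `p ≡ 0` the constant and linear terms cancel, and `hQ` bounds the coefficient of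
`-ψ²` from below. -/
lemma mainTerm_four_zero (hℓ : ℓ % 6 = 4) (hp : p % 6 = 0) (hpos : 0 < ℓ) (h0 : 0 < ψ)
    (hk : 360 * ((ℓ + p : ℝ) ^ 3 * ψ) ≤ 1)
    (hQ : (1 : ℝ) ≤ (ℓ + p) ^ 2 - 4 * (ℓ + p) * ℓ + ℓ ^ 2 + (ℓ + p) + ℓ) :
    ψ ^ 2 / 2 ≤ -mainTerm ℓ p (Real.pi / 3 + ψ) := by
  obtain ⟨hN, hNψ, hN2, herr, hψ⟩ := corner_smallness hpos h0 hk
  have h := abs_mainTerm_sub_le hℓ (show (ℓ + p) % 6 = 4 by omega) hp hpos h0.le hψ (by linarith)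
  rw [cornerTaylor_zero, cornerTaylor_four, cornerTaylor_four] at h
  have hs2 : (√3) ^ 2 = 3 := Real.sq_sqrt (by norm_num)
  set l : ℝ := (ℓ : ℝ)
  set q : ℝ := (p : ℝ)
  have e : -(1 / 2) * (1 - √3 * 0 * ψ - 2 * 0 * ψ ^ 2 + (3 * 0 ^ 2 - l ^ 2) * ψ ^ 2 / 2)
        + √3 / 2 * (l * ψ - √3 * 0 * l * ψ ^ 2)
      + (-(1 / 2) * (1 - √3 * q * ψ - 2 * q * ψ ^ 2 + (3 * q ^ 2 - (l + q) ^ 2) * ψ ^ 2 / 2)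
        + √3 / 2 * ((l + q) * ψ - √3 * q * (l + q) * ψ ^ 2))
      + (1 - √3 * (l + q) * ψ - 2 * (l + q) * ψ ^ 2 + (3 * (l + q) ^ 2 - q ^ 2) * ψ ^ 2 / 2)
      = -(((l + q) ^ 2 - 4 * (l + q) * l + l ^ 2 + (l + q) + l) * ψ ^ 2) := by
    linear_combination (-(l + q) * q * ψ ^ 2 / 2) * hs2
  rw [e, abs_le] at h
  nlinarith [h.2, mul_le_mul_of_nonneg_right hQ (sq_nonneg ψ)]

end Corner

/-! ### An additional sample point next to the corner -/

lemma sqrt_four_fifths_le : √(4 / 5 : ℝ) ≤ 9 / 10 := by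
  rw [Real.sqrt_le_left (by norm_num)]
  norm_num

/-- The conditions on a large `ℓ` which the sample points near the corner require. The angle
`ψ = (99/100)^ℓ` above the corner is so small that polynomials in `ℓ` times `ψ` are negligible,
while `ψ²` still exceeds the error of the main term. -/
lemma exists_corner_threshold : ∃ L : ℕ, 1000 ≤ L ∧ ∀ ℓ : ℕ, L ≤ ℓ →
    errConst * √(4 / 5) ^ ℓ < ((99 / 100 : ℝ) ^ ℓ) ^ 2 ∧
      360 * ((ℓ : ℝ) ^ 6 * (99 / 100 : ℝ) ^ ℓ) ≤ 1 := by
  have t1 := tendsto_pow_const_mul_const_pow_of_lt_one 6 (r := (99 / 100 : ℝ)) (by norm_num)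
    (by norm_num)
  have t2 := (tendsto_pow_atTop_nhds_zero_of_lt_one (r := (93 / 100 : ℝ)) (by norm_num)
    (by norm_num)).const_mul errConst
  rw [mul_zero] at t2
  have e1 := t1.eventually_lt_const (show (0 : ℝ) < 1 / 360 by norm_num)
  have e2 := t2.eventually_lt_const (show (0 : ℝ) < 1 by norm_num)
  obtain ⟨L, hL⟩ := Filter.eventually_atTop.1 (e1.and e2)
  refine ⟨max L 1000, le_max_right _ _, fun ℓ hℓ => ?_⟩
  obtain ⟨h1, h2⟩ := hL ℓ ((le_max_left _ _).trans hℓ)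
  refine ⟨?_, by linarith⟩
  have hE := errConst_nonneg
  have h3 : √(4 / 5 : ℝ) ^ ℓ ≤ (93 / 100 : ℝ) ^ ℓ * ((99 / 100 : ℝ) ^ ℓ) ^ 2 := by
    rw [← pow_mul, mul_comm ℓ 2, pow_mul, ← mul_pow]
    gcongr
    exact sqrt_four_fifths_le.trans (by norm_num)
  calc errConst * √(4 / 5) ^ ℓ
      ≤ (errConst * (93 / 100 : ℝ) ^ ℓ) * ((99 / 100 : ℝ) ^ ℓ) ^ 2 := by
        rw [mul_assoc]; gcongr
    _ < 1 * ((99 / 100 : ℝ) ^ ℓ) ^ 2 := by gcongr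
    _ = _ := one_mul _

/-- Where the main term exceeds the error, it gives the sign of `Δ`. -/
lemma sign_lineDelta_of_mainTerm {θ σ : ℝ} (hσ : |σ| = 1) (h1 : Real.pi / 3 ≤ θ)
    (h2 : θ < Real.pi / 2) (h8 : 1 ≤ 8 * (2 * Real.cos θ) ^ 2) {ℓ p : ℕ} (hℓ : 4 ≤ ℓ)
    (eℓ : Even ℓ) (ep : Even p) (h : errConst * √(4 / 5) ^ ℓ < 2 * (σ * mainTerm ℓ p θ)) :
    0 < σ * lineDelta (ℓ + p) ℓ (Real.tan θ / 2) := by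
  have hb := abs_lineDelta_sub_mainTerm_le h1 h2 h8 hℓ eℓ ep
  have hc := cos_pos_of_lt h1 h2
  have ha : 0 < (2 * Real.cos θ) ^ ℓ := by positivity
  rw [← one_mul |_|, ← hσ, ← abs_mul, abs_le] at hb
  have := mul_lt_mul_of_pos_right h ha
  nlinarith [hb.1]

lemma one_le_eight_mul_sq {ψ : ℝ} (h0 : 0 ≤ ψ) (h1 : ψ ≤ 1 / 100) :
    1 ≤ 8 * (2 * Real.cos (Real.pi / 3 + ψ)) ^ 2 := by
  have hs2 : (√3) ^ 2 = 3 := Real.sq_sqrt (by norm_num)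
  have hs0 : 0 ≤ √3 := Real.sqrt_nonneg 3
  have hs1 : √3 ≤ 2 := by nlinarith
  have h2 := Real.one_sub_sq_div_two_le_cos (x := ψ)
  have h3 := Real.sin_le h0
  have h4 : √3 * Real.sin ψ ≤ 2 * ψ := by
    calc √3 * Real.sin ψ ≤ √3 * ψ := by gcongr
      _ ≤ 2 * ψ := by gcongr
  rw [two_cos_add_eq]
  have : 9 / 10 ≤ Real.cos ψ - √3 * Real.sin ψ := by nlinarith
  nlinarith

lemma two_cos_pow_le_of_large {ℓ p n : ℕ} (hℓ : 1000 ≤ ℓ) (hp : ℓ ^ 2 ≤ ℓ + p) (hn : p ≤ n) :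
    (2 * Real.cos (Real.pi / 3 + 1 / (10 * ℓ))) ^ n ≤ 1 / 50 := by
  have hℓR : (1000 : ℝ) ≤ ℓ := by exact_mod_cast hℓ
  have hψ1 : (1 : ℝ) / (10 * ℓ) ≤ Real.pi / 6 := by
    rw [div_le_div_iff₀ (by positivity) (by norm_num)]
    nlinarith [Real.pi_gt_three]
  refine (two_cos_pow_le_exp (by positivity) hψ1 n).trans ?_
  have hs1 : 1 ≤ √3 := Real.one_le_sqrt.2 (by norm_num)
  have hnR : (ℓ : ℝ) ^ 2 ≤ ℓ + n := by exact_mod_cast hp.trans (by omega)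
  have hb : (49 : ℝ) ≤ n * (1 / (10 * ℓ)) := by
    rw [mul_one_div, le_div_iff₀ (by positivity)]
    nlinarith
  have := Real.add_one_le_exp (√3 * (n * (1 / (10 * ℓ))))
  rw [Real.exp_neg, ← one_div]
  exact one_div_le_one_div_of_le (by norm_num) (by nlinarith)

/-- When `k` is much larger than `ℓ`, only the first summand of the main term matters slightly
above the corner. -/
lemma abs_mainTerm_sub_cos_le {ℓ p : ℕ} (hℓ : 1000 ≤ ℓ) (hp : ℓ ^ 2 ≤ ℓ + p) :
    |mainTerm ℓ p (Real.pi / 3 + 1 / (10 * ℓ))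
      - Real.cos (ℓ * (Real.pi / 3 + 1 / (10 * ℓ)))| ≤ 1 / 25 := by
  have b1 := two_cos_pow_le_of_large hℓ hp le_rfl
  have b2 := two_cos_pow_le_of_large hℓ hp (Nat.le_add_left p ℓ)
  have hℓR : (1000 : ℝ) ≤ ℓ := by exact_mod_cast hℓ
  have hcpos : 0 < Real.cos (Real.pi / 3 + 1 / (10 * ℓ)) := by
    have : (1 : ℝ) / (10 * ℓ) < Real.pi / 6 := by
      rw [div_lt_div_iff₀ (by positivity) (by norm_num)]
      nlinarith [Real.pi_gt_three]
    have : 0 < (1 : ℝ) / (10 * ℓ) := by positivity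
    exact cos_pos_of_lt (by linarith) (by linarith)
  unfold mainTerm
  set θ := Real.pi / 3 + 1 / (10 * (ℓ : ℝ))
  have c1 : |(2 * Real.cos θ) ^ p * Real.cos ((ℓ + p : ℕ) * θ)| ≤ 1 / 50 * 1 := by
    rw [abs_mul, abs_of_pos (by positivity)]
    exact mul_le_mul b1 (Real.abs_cos_le_one _) (abs_nonneg _) (by norm_num)
  have c2 : |(2 * Real.cos θ) ^ (ℓ + p) * Real.cos (p * θ)| ≤ 1 / 50 * 1 := by
    rw [abs_mul, abs_of_pos (by positivity)]
    exact mul_le_mul b2 (Real.abs_cos_le_one _) (abs_nonneg _) (by norm_num)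
  rw [abs_le] at c1 c2 ⊢
  constructor <;> linarith [c1.1, c1.2, c2.1, c2.2]

lemma cos_one_tenth_ge : (99 / 100 : ℝ) ≤ Real.cos (1 / 10) := by
  have := Real.one_sub_sq_div_two_le_cos (x := 1 / 10)
  norm_num at this ⊢
  linarith

/-- For `ℓ ≡ 0` or `4` modulo `6` there is one more sample point between the corner and the other
sample points: the sign of `Δ` there is that of `E_k E_ℓ - E_{k+ℓ}` at the corner or, if this value
vanishes, that of the first derivative that does not. -/
lemma exists_corner_sample : ∃ L : ℕ, 1000 ≤ L ∧ ∀ ℓ p : ℕ, L ≤ ℓ → Even ℓ → Even p →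
    ((ℓ % 6 = 0 → (p % 6 = 2 → (1 : ℝ) ≤ 2 * (ℓ + p) * p - ℓ ^ 2 + ℓ + 2 * p) →
      ∃ ψ : ℝ, 0 ≤ ψ ∧ ψ ≤ 1 / (10 * ℓ) ∧
        0 < lineDelta (ℓ + p) ℓ (Real.tan (Real.pi / 3 + ψ) / 2)) ∧
    (ℓ % 6 = 4 → (p % 6 = 2 → (1 : ℝ) ≤ p - ℓ) →
      (p % 6 = 0 → (1 : ℝ) ≤ (ℓ + p) ^ 2 - 4 * (ℓ + p) * ℓ + ℓ ^ 2 + (ℓ + p) + ℓ) →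
      ∃ ψ : ℝ, 0 ≤ ψ ∧ ψ ≤ 1 / (10 * ℓ) ∧
        lineDelta (ℓ + p) ℓ (Real.tan (Real.pi / 3 + ψ) / 2) < 0)) := by
  obtain ⟨L, hL1000, hL⟩ := exists_corner_threshold
  refine ⟨L, hL1000, fun ℓ p hLℓ eℓ ep => ?_⟩
  obtain ⟨herr, hsmall⟩ := hL ℓ hLℓ
  have hℓ : 1000 ≤ ℓ := hL1000.trans hLℓ
  have hℓR : (1000 : ℝ) ≤ ℓ := by exact_mod_cast hℓ
  set ψ₀ : ℝ := (99 / 100 : ℝ) ^ ℓ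
  have hψ0 : 0 < ψ₀ := by positivity
  have hψ1 : ψ₀ ≤ 1 / (10 * ℓ) := by
    rw [le_div_iff₀ (by positivity)]
    have : (ℓ : ℝ) ≤ (ℓ : ℝ) ^ 6 := le_self_pow₀ (by linarith) (by norm_num)
    have := mul_le_mul_of_nonneg_right this hψ0.le
    nlinarith
  have hbound : (1 : ℝ) / (10 * ℓ) ≤ 1 / 10000 := by
    apply one_div_le_one_div_of_le (by norm_num); linarith
  have hpi := Real.pi_gt_three
  have herr' : errConst * √(4 / 5) ^ ℓ < 1 / 10 := by
    nlinarith
  have sgn : ∀ ψ σ : ℝ, |σ| = 1 → 0 ≤ ψ → ψ ≤ 1 / (10 * ℓ) →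
      errConst * √(4 / 5) ^ ℓ < 2 * (σ * mainTerm ℓ p (Real.pi / 3 + ψ)) →
      0 < σ * lineDelta (ℓ + p) ℓ (Real.tan (Real.pi / 3 + ψ) / 2) := fun ψ σ hσ h0 h1 h =>
    sign_lineDelta_of_mainTerm hσ (by linarith) (by linarith)
      (one_le_eight_mul_sq h0 (by linarith)) (by omega) eℓ ep h
  have hpos : ∀ ψ : ℝ, 0 ≤ ψ → ψ ≤ 1 / (10 * ℓ) →
      errConst * √(4 / 5) ^ ℓ < 2 * mainTerm ℓ p (Real.pi / 3 + ψ) →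
      0 < lineDelta (ℓ + p) ℓ (Real.tan (Real.pi / 3 + ψ) / 2) := fun ψ h0 h1 h => by
    have := sgn ψ 1 (by norm_num) h0 h1 (by linarith)
    linarith
  have hneg : ∀ ψ : ℝ, 0 ≤ ψ → ψ ≤ 1 / (10 * ℓ) →
      errConst * √(4 / 5) ^ ℓ < 2 * -mainTerm ℓ p (Real.pi / 3 + ψ) →
      lineDelta (ℓ + p) ℓ (Real.tan (Real.pi / 3 + ψ) / 2) < 0 := fun ψ h0 h1 h => by
    have := sgn ψ (-1) (by norm_num) h0 h1 (by linarith)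
    linarith
  have hnn : (0 : ℝ) ≤ 1 / (10 * ℓ) := by positivity
  have hval : mainTerm ℓ p (Real.pi / 3 + 0) = Real.cos (ℓ * (Real.pi / 3 + 0))
      + Real.cos ((ℓ + p : ℕ) * (Real.pi / 3 + 0)) + Real.cos (p * (Real.pi / 3 + 0)) := by
    have e : 2 * Real.cos (Real.pi / 3 + 0) = 1 := by
      rw [add_zero, Real.cos_pi_div_three]; norm_num
    rw [mainTerm, e, one_pow, one_pow, one_mul, one_mul]
  have hp6 : p % 6 = 0 ∨ p % 6 = 2 ∨ p % 6 = 4 := by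
    have := Nat.even_iff.1 ep
    omega
  -- for `k ≥ ℓ²` the angle `1/(10ℓ)` serves, for smaller `k` the Taylor expansion applies at `ψ₀`
  have hlarge : ℓ ^ 2 ≤ ℓ + p ∨ 360 * ((ℓ + p : ℝ) ^ 3 * ψ₀) ≤ 1 := by
    rcases le_total (ℓ ^ 2) (ℓ + p) with h | h
    · exact Or.inl h
    · right
      have h' : (ℓ + p : ℝ) ≤ (ℓ : ℝ) ^ 2 := by exact_mod_cast h
      have : (ℓ + p : ℝ) ^ 3 ≤ (ℓ : ℝ) ^ 6 := by
        calc (ℓ + p : ℝ) ^ 3 ≤ ((ℓ : ℝ) ^ 2) ^ 3 := by gcongr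
          _ = _ := by ring
      have := mul_le_mul_of_nonneg_right this hψ0.le
      linarith
  have e10 : (ℓ : ℝ) * (1 / (10 * ℓ)) = 1 / 10 := by field_simp
  have hcos10 := cos_one_tenth_ge
  refine ⟨fun hℓ6 hQ => ?_, fun hℓ6 hQ2 hQ0 => ?_⟩
  · rcases hlarge with h | h
    · refine ⟨1 / (10 * ℓ), hnn, le_rfl, hpos _ hnn le_rfl ?_⟩
      have h1 := abs_le.1 (abs_mainTerm_sub_cos_le hℓ h)
      rw [cos_nat_mul_add (p := ℓ) (i := 0) (s := ℓ / 6) (by omega), e10, Nat.cast_zero, zero_mul,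
        zero_add] at h1
      linarith [h1.1]
    · rcases hp6 with hp | hp | hp
      · refine ⟨0, le_rfl, hnn, hpos _ le_rfl hnn ?_⟩
        rw [hval, cos_nat_mul_add (p := ℓ) (i := 0) (s := ℓ / 6) (by omega),
          cos_nat_mul_add (p := ℓ + p) (i := 0) (s := (ℓ + p) / 6) (by omega),
          cos_nat_mul_add (p := p) (i := 0) (s := p / 6) (by omega)]
        simp only [Nat.cast_zero, zero_mul, mul_zero, add_zero, Real.cos_zero]
        linarith
      · refine ⟨ψ₀, hψ0.le, hψ1, hpos _ hψ0.le hψ1 ?_⟩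
        have := mainTerm_zero_two hℓ6 hp (by omega) hψ0 h (hQ hp)
        linarith
      · refine ⟨ψ₀, hψ0.le, hψ1, hpos _ hψ0.le hψ1 ?_⟩
        have := mainTerm_zero_four hℓ6 hp (by omega) hψ0 h
        linarith
  · rcases hlarge with h | h
    · refine ⟨1 / (10 * ℓ), hnn, le_rfl, hneg _ hnn le_rfl ?_⟩
      have h1 := abs_le.1 (abs_mainTerm_sub_cos_le hℓ h)
      rw [cos_nat_mul_add (p := ℓ) (i := 4) (s := ℓ / 6) (by omega), e10,
        cos_four_pi_div_three_add] at h1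
      have hs2 : (√3) ^ 2 = 3 := Real.sq_sqrt (by norm_num)
      have hs0 : 0 ≤ √3 := Real.sqrt_nonneg 3
      have hs1 : √3 ≤ 2 := by nlinarith
      have h3 := Real.sin_le (show (0 : ℝ) ≤ 1 / 10 by norm_num)
      have h4 : √3 * Real.sin (1 / 10) ≤ 2 * (1 / 10) := by
        calc √3 * Real.sin (1 / 10) ≤ √3 * (1 / 10) := by gcongr
          _ ≤ 2 * (1 / 10) := by gcongr
      linarith [h1.2]
    · rcases hp6 with hp | hp | hp
      · refine ⟨ψ₀, hψ0.le, hψ1, hneg _ hψ0.le hψ1 ?_⟩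
        have := mainTerm_four_zero hℓ6 hp (by omega) hψ0 h (hQ0 hp)
        linarith
      · refine ⟨ψ₀, hψ0.le, hψ1, hneg _ hψ0.le hψ1 ?_⟩
        have := mainTerm_four_two hℓ6 hp (by omega) hψ0 h (hQ2 hp)
        linarith
      · refine ⟨0, le_rfl, hnn, hneg _ le_rfl hnn ?_⟩
        rw [hval, cos_nat_mul_add (p := ℓ) (i := 4) (s := ℓ / 6) (by omega),
          cos_nat_mul_add (p := ℓ + p) (i := 2) (s := (ℓ + p) / 6) (by omega),
          cos_nat_mul_add (p := p) (i := 4) (s := p / 6) (by omega)]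
        simp only [mul_zero]
        rw [cos_four_pi_div_three_add, cos_two_pi_div_three_add]
        simp only [Real.cos_zero, Real.sin_zero]
        linarith

/-! ### The stabilization point -/

/-- The equation `A (A + 1) = 3 h²` has no solution with `A ≡ 2` modulo `3`: `A` would be a square,
being coprime to `(A + 1) / 3`. -/
lemma mul_add_one_ne_three_mul_sq {A h : ℤ} (hA0 : 0 ≤ A) (hA : A % 3 = 2) :
    A * (A + 1) ≠ 3 * h ^ 2 := by
  intro he
  obtain ⟨c, hc⟩ : (3 : ℤ) ∣ A + 1 := by omega
  have hac : A * c = h ^ 2 := by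
    rw [hc] at he
    linarith
  have hcop : IsCoprime A c := ⟨-1, 3, by linarith⟩
  obtain ⟨a, ha | ha⟩ := Int.sq_of_isCoprime hcop hac
  · have : a % 3 = 0 ∨ a % 3 = 1 ∨ a % 3 = 2 := by omega
    rcases this with h | h | h <;> simp [ha, pow_two, Int.mul_emod, h] at hA
  · have : A = 0 := by nlinarith [sq_nonneg a]
    omega

/-- For `ℓ ≡ 0`, `j ≡ 2` the coefficient of `ψ²` is even and `k ≥ sp_j(ℓ)` says that it is at
least `-1`; the value `0` is excluded by `mul_add_one_ne_three_mul_sq`. -/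
lemma stabPoint_zero_two {ℓ p j : ℕ} (hℓ : ℓ % 6 = 0) (hp : p % 6 = 2) (hj : j % 6 = 2)
    (hpos : 0 < ℓ) (h : stabPoint j ℓ ≤ ((ℓ + p : ℕ) : ℝ)) :
    (1 : ℝ) ≤ 2 * (ℓ + p) * p - ℓ ^ 2 + ℓ + 2 * p := by
  rw [stabPoint, if_pos ⟨hℓ, hj⟩] at h
  push_cast at h
  have h1 : √(3 * (ℓ : ℝ) ^ 2 - 1) ≤ ℓ + 2 * p + 1 := by linarith
  have hnn : (0 : ℝ) ≤ 3 * (ℓ : ℝ) ^ 2 - 1 := by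
    have : (1 : ℝ) ≤ ℓ := by exact_mod_cast hpos
    nlinarith
  have h2 := (Real.sqrt_le_left (by positivity)).1 h1
  obtain ⟨s, rfl⟩ : ∃ s, ℓ = 6 * s := ⟨ℓ / 6, by omega⟩
  have hA := mul_add_one_ne_three_mul_sq (A := (3 * s + p : ℤ)) (h := 3 * s) (by positivity)
    (by omega)
  have h3 : 3 * (6 * s : ℤ) ^ 2 - 1 ≤ (6 * s + 2 * p + 1) ^ 2 := by
    push_cast at h2
    exact_mod_cast h2
  have h4 : 3 * (3 * s : ℤ) ^ 2 < (3 * s + p) * (3 * s + p + 1) := by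
    refine lt_of_le_of_ne ?_ (Ne.symm hA)
    by_contra hcon
    push Not at hcon
    nlinarith
  have h5 : (1 : ℤ) ≤ 2 * (6 * s + p) * p - (6 * s) ^ 2 + 6 * s + 2 * p := by nlinarith
  push_cast
  exact_mod_cast h5

/-- For `ℓ ≡ 4`, `j ≡ 2` equality `k = 2ℓ` is impossible modulo `6`. -/
lemma stabPoint_four_two {ℓ p j : ℕ} (hℓ : ℓ % 6 = 4) (hp : p % 6 = 2) (hj : j % 6 = 2)
    (h : stabPoint j ℓ ≤ ((ℓ + p : ℕ) : ℝ)) : (1 : ℝ) ≤ p - ℓ := by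
  rw [stabPoint, if_neg (by omega), if_pos ⟨hℓ, hj⟩] at h
  have h1 : 2 * ℓ ≤ ℓ + p := by exact_mod_cast h
  have h2 : ℓ + 1 ≤ p := by omega
  have h3 : (ℓ + 1 : ℝ) ≤ p := by exact_mod_cast h2
  linarith

lemma stabPoint_four_zero {ℓ p j : ℕ} (hℓ : ℓ % 6 = 4) (hj : j % 6 = 0)
    (h : stabPoint j ℓ ≤ ((ℓ + p : ℕ) : ℝ)) (hne : ((ℓ + p : ℕ) : ℝ) ≠ stabPoint j ℓ) :
    (1 : ℝ) ≤ (ℓ + p) ^ 2 - 4 * (ℓ + p) * ℓ + ℓ ^ 2 + (ℓ + p) + ℓ := by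
  have hlt := lt_of_le_of_ne h hne.symm
  rw [stabPoint, if_neg (by omega), if_neg (by omega), if_pos ⟨hℓ, hj⟩] at hlt
  push_cast at hlt
  have h1 : √(12 * (ℓ : ℝ) ^ 2 - 12 * ℓ + 1) < 2 * (ℓ + p) - 4 * ℓ + 1 := by linarith
  have h0 := (Real.sqrt_nonneg _).trans_lt h1
  have h2 := (Real.sqrt_lt' h0).1 h1
  have h3 : (0 : ℝ) < (ℓ + p) ^ 2 - 4 * (ℓ + p) * ℓ + ℓ ^ 2 + (ℓ + p) + ℓ := by nlinarith
  have h4 : (0 : ℤ) < (ℓ + p) ^ 2 - 4 * (ℓ + p) * ℓ + ℓ ^ 2 + (ℓ + p) + ℓ := by exact_mod_cast h3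
  exact_mod_cast h4

/-! ### Counting zeros -/

lemma continuousOn_lineDelta {k ℓ : ℕ} (hk : 4 ≤ k) (hℓ : 4 ≤ ℓ) (ek : Even k) (eℓ : Even ℓ) :
    ContinuousOn (lineDelta k ℓ) (Set.Ici (√3 / 2)) := by
  have hcont : Continuous (eisensteinDelta hk hℓ) := by
    unfold eisensteinDelta
    exact ((ModularFormClass.holo _).continuous.mul (ModularFormClass.holo _).continuous).sub
      (ModularFormClass.holo _).continuous
  rw [continuousOn_iff_continuous_domRestrict]
  have hpt : Continuous fun y : Set.Ici (√3 / 2) => linePtH y.1 (pos_of_sqrt_three_le y.2) := by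
    rw [UpperHalfPlane.isEmbedding_coe.continuous_iff]
    have : Continuous fun y : Set.Ici (√3 / 2) => Complex.equivRealProdCLM.symm (1 / 2, y.1) :=
      Complex.equivRealProdCLM.symm.continuous.comp (by fun_prop)
    exact this
  have : Set.domRestrict (Set.Ici (√3 / 2)) (lineDelta k ℓ)
      = fun y => (eisensteinDelta hk hℓ (linePtH y.1 (pos_of_sqrt_three_le y.2))).re := by
    ext y
    rw [eisensteinDelta_linePt y.2 hk hℓ ek eℓ, Complex.ofReal_re, Set.domRestrict_apply]
  rw [this]
  exact Complex.continuous_re.comp (hcont.comp hpt)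

/-- A point of the line is determined by the modulus of its parameter `q = exp (2πiz)`. -/
lemma qParam_injOn_line : Set.InjOn (fun z : ℍ => Function.Periodic.qParam 1 (z : ℂ))
    {z : ℍ | z.re = 1 / 2} := by
  intro z hz w hw h
  have hn := congrArg norm h
  simp only [Function.Periodic.norm_qParam, UpperHalfPlane.coe_im, div_one] at hn
  have him : z.im = w.im := by
    have := Real.exp_injective hn
    have hpi := Real.pi_pos
    nlinarith
  apply UpperHalfPlane.ext
  apply Complex.ext
  · exact (hz : z.re = 1 / 2).trans (hw : w.re = 1 / 2).symm
  · exact him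

/-- The zeros on the side are finite in number: in the parameter `q`, the function `Δ` extends
analytically to the cusp `q = 0`, so its zeros cannot accumulate. -/
lemma finite_sideZeros {k ℓ : ℕ} (hk : 4 ≤ k) (hℓ : 4 ≤ ℓ) (ek : Even k) (eℓ : Even ℓ) {y : ℝ}
    (hy : √3 / 2 ≤ y) (hne : lineDelta k ℓ y ≠ 0) : (sideZeros hk hℓ).Finite := by
  have h1 : (1 : ℝ) ∈ (MonoidHom.range
      (Matrix.SpecialLinearGroup.mapGL (R := ℤ) (n := Fin 2) ℝ)).strictPeriods := by
    simp
  set D : ℂ → ℂ := fun q =>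
    UpperHalfPlane.cuspFunction 1 (ModularForm.E (show 3 ≤ k by omega)) q
      * UpperHalfPlane.cuspFunction 1 (ModularForm.E (show 3 ≤ ℓ by omega)) q
      - UpperHalfPlane.cuspFunction 1 (ModularForm.E (show 3 ≤ k + ℓ by omega)) q
  have hD : ∀ z : ℍ, D (Function.Periodic.qParam 1 (z : ℂ)) = eisensteinDelta hk hℓ z := by
    intro z
    simp only [D, eisensteinDelta]
    rw [SlashInvariantFormClass.eq_cuspFunction _ z h1 one_ne_zero,
      SlashInvariantFormClass.eq_cuspFunction _ z h1 one_ne_zero,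
      SlashInvariantFormClass.eq_cuspFunction _ z h1 one_ne_zero]
  set ρ : ℝ := Real.exp (-2 * Real.pi * (√3 / 2)) with hρ
  have hs : 0 < √3 := Real.sqrt_pos.2 (by norm_num)
  have hρ1 : ρ < 1 := by
    rw [hρ, Real.exp_lt_one_iff]
    nlinarith [Real.pi_pos]
  have hdiff : DifferentiableOn ℂ D (Metric.ball 0 1) := by
    intro q hq
    have hq1 : ‖q‖ < 1 := mem_ball_zero_iff.1 hq
    exact (((ModularFormClass.differentiableAt_cuspFunction _ one_pos h1 hq1).mul
      (ModularFormClass.differentiableAt_cuspFunction _ one_pos h1 hq1)).sub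
      (ModularFormClass.differentiableAt_cuspFunction _ one_pos h1 hq1)).differentiableWithinAt
  have han : AnalyticOnNhd ℂ D (Metric.closedBall 0 ρ) :=
    (hdiff.analyticOnNhd Metric.isOpen_ball).mono (Metric.closedBall_subset_ball hρ1)
  have hmem : ∀ z : ℍ, √3 / 2 ≤ z.im →
      Function.Periodic.qParam 1 (z : ℂ) ∈ Metric.closedBall (0 : ℂ) ρ := by
    intro z hz
    rw [mem_closedBall_zero_iff, Function.Periodic.norm_qParam, hρ, Real.exp_le_exp,
      UpperHalfPlane.coe_im, div_one]
    nlinarith [Real.pi_pos]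
  rcases han.eqOn_zero_or_eventually_ne_zero_of_preconnected
    (convex_closedBall 0 ρ).isPreconnected with h | h
  · have h0 := h (hmem (linePtH y (pos_of_sqrt_three_le hy)) hy)
    rw [hD, eisensteinDelta_linePt hy hk hℓ ek eℓ] at h0
    exact absurd (by simpa using h0) hne
  · have hfin := (isCompact_closedBall (0 : ℂ) ρ).finite_sdiff_of_mem_codiscreteWithin h
    refine Set.Finite.of_finite_image (f := fun z : ℍ => Function.Periodic.qParam 1 (z : ℂ))
      (hfin.subset ?_) (qParam_injOn_line.mono fun z hz => hz.1)
    rintro _ ⟨z, ⟨_, hz2, hz3⟩, rfl⟩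
    exact ⟨hmem z hz2.le, fun hcon => hcon ((hD z).trans hz3)⟩

/-- Sign changes along a decreasing sequence of angles produce zeros on the side. -/
lemma le_sideZeroCount {k ℓ : ℕ} (hk : 4 ≤ k) (hℓ : 4 ≤ ℓ) (ek : Even k) (eℓ : Even ℓ)
    (t : ℕ → ℝ) (M c : ℕ) (h1 : ∀ i ≤ M, Real.pi / 3 ≤ t i ∧ t i < Real.pi / 2)
    (h2 : ∀ i < M, t (i + 1) < t i)
    (h3 : ∀ i ≤ M, 0 < (-1) ^ (c + i) * lineDelta k ℓ (Real.tan (t i) / 2)) :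
    (sideZeros hk hℓ).Finite ∧ M ≤ sideZeroCount hk hℓ := by
  have hfin : (sideZeros hk hℓ).Finite := by
    refine finite_sideZeros hk hℓ ek eℓ
      (tan_pi_div_three_le (h1 0 (Nat.zero_le _)).1 (h1 0 (Nat.zero_le _)).2) fun h0 => ?_
    have := h3 0 (Nat.zero_le _)
    rw [h0, mul_zero] at this
    exact lt_irrefl _ this
  refine ⟨hfin, ?_⟩
  set s : ℕ → ℝ := fun i => Real.tan (t i) / 2 with hs
  have hpi := Real.pi_pos
  have hsc : ∀ i ≤ M, √3 / 2 ≤ s i := fun i hi => tan_pi_div_three_le (h1 i hi).1 (h1 i hi).2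
  have hslt : ∀ i < M, s (i + 1) < s i := by
    intro i hi
    have a := h1 (i + 1) hi
    have b := h1 i hi.le
    have := Real.strictMonoOn_tan ⟨by linarith, a.2⟩ ⟨by linarith, b.2⟩ (h2 i hi)
    simp only [hs]
    linarith
  have hcont := continuousOn_lineDelta hk hℓ ek eℓ
  have hz : ∀ i, ∃ w, i < M → (w ∈ Set.Ioo (s (i + 1)) (s i) ∧ lineDelta k ℓ w = 0) := by
    intro i
    by_cases hi : i < M
    swap
    · exact ⟨0, fun h => absurd h hi⟩
    have a := h3 (i + 1) hi
    have b := h3 i hi.le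
    rw [← add_assoc, pow_succ] at a
    have hc : ContinuousOn (fun w => (-1) ^ (c + i) * lineDelta k ℓ w)
        (Set.Icc (s (i + 1)) (s i)) :=
      (hcont.mono fun w hw => (hsc (i + 1) hi).trans hw.1).const_smul ((-1 : ℝ) ^ (c + i))
    obtain ⟨w, hw, hw0⟩ := intermediate_value_Ioo (hslt i hi).le hc
      (show (0 : ℝ) ∈ Set.Ioo _ _ from ⟨by linarith, b⟩)
    refine ⟨w, fun _ => ⟨hw, ?_⟩⟩
    exact (mul_eq_zero.1 hw0).resolve_left (pow_ne_zero _ (by norm_num))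
  choose w hw using hz
  have hanti : ∀ i j, i ≤ j → j ≤ M → s j ≤ s i := by
    intro i j hij
    induction j, hij using Nat.le_induction with
    | base => exact fun _ => le_rfl
    | succ j _ ih => exact fun hj => (hslt j hj).le.trans (ih (by omega))
  have hwinj : ∀ i j, i < j → j < M → w j < w i := fun i j hij hj =>
    ((hw j hj).1.2.trans_le (hanti (i + 1) j hij hj.le)).trans (hw i (hij.trans hj)).1.1
  have hwc : ∀ i < M, √3 / 2 < w i := fun i hi => (hsc (i + 1) hi).trans_lt (hw i hi).1.1
  -- the zeros lie in disjoint open intervals, hence are distinct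
  set F : Fin M → ℍ := fun i => linePtH (w i) (pos_of_sqrt_three_le (hwc i i.2).le)
  have hFinj : Function.Injective F := by
    intro i j hij
    have him : w i = w j := congrArg UpperHalfPlane.im hij
    by_contra hne
    rcases lt_or_gt_of_ne (fun h => hne (Fin.ext h) : (i : ℕ) ≠ j) with h | h
    · exact (hwinj i j h j.2).ne' him
    · exact (hwinj j i h i.2).ne him
  have hsub : Set.range F ⊆ sideZeros hk hℓ := by
    rintro _ ⟨i, rfl⟩
    refine ⟨rfl, hwc i i.2, ?_⟩
    rw [eisensteinDelta_linePt (hwc i i.2).le hk hℓ ek eℓ, (hw i i.2).2, Complex.ofReal_zero]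
  have := Set.ncard_le_ncard hsub hfin
  rw [← Set.image_univ, Set.ncard_image_of_injective _ hFinj, Set.ncard_univ,
    Nat.card_eq_fintype_card, Fintype.card_fin] at this
  exact this

/-- At the sample points `Δ` has alternating signs. -/
lemma sign_lineDelta_sampleAngle : ∃ L : ℕ, ∀ h ℓ m p : ℕ, L ≤ ℓ → ℓ = 2 * h → 0 < m →
    6 * m + 2 ≤ ℓ → Even p →
    0 < (-1) ^ (h + m) * lineDelta (ℓ + p) ℓ (Real.tan (sampleAngle ℓ m) / 2) := by
  obtain ⟨L₁, h₁⟩ := lineDelta_sampleAngle_high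
  obtain ⟨L₂, h1000, h₂⟩ := exists_corner_threshold
  refine ⟨max L₁ L₂, fun h ℓ m p hL hℓ hm0 hm ep => ?_⟩
  have hL₁ : L₁ ≤ ℓ := (le_max_left _ _).trans hL
  have hL₂ : L₂ ≤ ℓ := (le_max_right _ _).trans hL
  -- `|z|² = 8` separates the two ways of estimating `Δ`
  rcases le_total 8 (lineNorm (Real.tan (sampleAngle ℓ m) / 2) ^ 2) with h8 | h8
  · exact h₁ h ℓ m p hL₁ hℓ hm0 hm ep h8
  · have hpi := Real.pi_pos
    have hposR : (0 : ℝ) < ℓ := by exact_mod_cast (by omega : 0 < ℓ)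
    have hmR : (6 * m + 2 : ℝ) ≤ ℓ := by exact_mod_cast hm
    have hm0R : (0 : ℝ) < m := by exact_mod_cast hm0
    have hθ1 : Real.pi / 3 ≤ sampleAngle ℓ m := by
      rw [sampleAngle_eq]
      have : Real.pi * m / ℓ ≤ Real.pi / 6 := by
        rw [div_le_div_iff₀ hposR (by norm_num)]
        nlinarith
      linarith
    have hθ2 : sampleAngle ℓ m < Real.pi / 2 := by
      have : 0 < Real.pi * m / ℓ := by positivity
      unfold sampleAngle
      linarith
    have hc := cos_pos_of_lt hθ1 hθ2
    rw [lineNorm_tan hc, inv_pow, inv_le_comm₀ (by positivity) (by norm_num)] at h8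
    refine sign_lineDelta_of_mainTerm (by rw [abs_pow, abs_neg, abs_one, one_pow]) hθ1 hθ2
      (by linarith) (by omega) ⟨h, by omega⟩ ep ?_
    have hA := mainTerm_sampleAngle hℓ hm ep
    have hE := (h₂ ℓ hL₂).1
    have hsq : ((99 / 100 : ℝ) ^ ℓ) ^ 2 ≤ 1 / 4 := by
      have h6 := (h₂ ℓ hL₂).2
      have hψ : 0 < (99 / 100 : ℝ) ^ ℓ := by positivity
      have h1 : (1 : ℝ) ≤ (ℓ : ℝ) ^ 6 := one_le_pow₀ (by exact_mod_cast (by omega : 1 ≤ ℓ))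
      have := mul_le_mul_of_nonneg_right h1 hψ.le
      nlinarith
    linarith

lemma sampleAngle_bounds {ℓ m : ℕ} (hm0 : 0 < m) (hm : 6 * m + 2 ≤ ℓ) :
    Real.pi / 3 + 1 / (10 * ℓ) < sampleAngle ℓ m ∧ sampleAngle ℓ m < Real.pi / 2 := by
  have hpi := Real.pi_gt_three
  have hposR : (0 : ℝ) < ℓ := by exact_mod_cast (by omega : 0 < ℓ)
  have hmR : (6 * m + 2 : ℝ) ≤ ℓ := by exact_mod_cast hm
  have hm0R : (0 : ℝ) < m := by exact_mod_cast hm0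
  constructor
  · have e : sampleAngle ℓ m - (Real.pi / 3 + 1 / (10 * ℓ))
        = (Real.pi * (ℓ - 6 * m) / 6 - 1 / 10) / ℓ := by
      rw [sampleAngle]; field_simp; ring
    have : 0 < (Real.pi * (ℓ - 6 * m) / 6 - 1 / 10) / ℓ := by
      apply div_pos _ hposR
      nlinarith
    linarith
  · have : 0 < Real.pi * m / ℓ := by positivity
    unfold sampleAngle
    linarith

lemma sampleAngle_succ_lt {ℓ : ℕ} (hℓ : 0 < ℓ) (m : ℕ) :
    sampleAngle ℓ (m + 1) < sampleAngle ℓ m := by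
  have hposR : (0 : ℝ) < ℓ := by exact_mod_cast hℓ
  unfold sampleAngle
  have : Real.pi * m / ℓ < Real.pi * (m + 1 : ℕ) / ℓ := by
    push_cast
    gcongr
    linarith
  linarith

lemma sideBound_eq {ℓ s i : ℕ} (hi : i < 6) (h : ℓ = 6 * s + i) :
    sideBound ℓ = if i = 4 then (s : ℤ) else s - 1 := by
  have hf : ⌊(ℓ : ℝ) / 6⌋ = (s : ℤ) := by
    rw [Int.floor_eq_iff]
    have hi' : (i : ℝ) < 6 := by exact_mod_cast hi
    have hi0 : (0 : ℝ) ≤ i := by positivity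
    subst h
    push_cast
    constructor
    · linarith
    · linarith
  have : ℓ % 6 = i := by omega
  rw [sideBound, hf, this]

/-- The sample points of index `1, …, M` together with one more below them give `M` zeros. -/
lemma le_sideZeroCount_of_corner {h ℓ p M : ℕ} {ψ : ℝ} (hk : 4 ≤ ℓ + p) (hℓ4 : 4 ≤ ℓ)
    (hℓ : ℓ = 2 * h) (ep : Even p) (hM : 6 * M + 2 ≤ ℓ)
    (hs : ∀ m, 0 < m → 6 * m + 2 ≤ ℓ →
      0 < (-1) ^ (h + m) * lineDelta (ℓ + p) ℓ (Real.tan (sampleAngle ℓ m) / 2))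
    (h0 : 0 ≤ ψ) (h1 : ψ ≤ 1 / (10 * ℓ))
    (hψ : 0 < (-1) ^ (h + (M + 1)) * lineDelta (ℓ + p) ℓ (Real.tan (Real.pi / 3 + ψ) / 2)) :
    (sideZeros hk hℓ4).Finite ∧ M ≤ sideZeroCount hk hℓ4 := by
  have eℓ : Even ℓ := ⟨h, by omega⟩
  have hpi := Real.pi_gt_three
  have hbound : (1 : ℝ) / (10 * ℓ) ≤ 1 / 40 := by
    have : (4 : ℝ) ≤ ℓ := by exact_mod_cast hℓ4
    apply one_div_le_one_div_of_le (by norm_num); linarith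
  have hnn : (0 : ℝ) ≤ 1 / (10 * ℓ) := by positivity
  refine le_sideZeroCount hk hℓ4 (eℓ.add ep) eℓ
    (fun i => if i < M then sampleAngle ℓ (i + 1) else Real.pi / 3 + ψ) M (h + 1)
    (fun i hi => ?_) (fun i hi => ?_) (fun i hi => ?_)
  · split_ifs with hlt
    · have := sampleAngle_bounds (Nat.succ_pos i) (show 6 * (i + 1) + 2 ≤ ℓ by omega)
      exact ⟨by linarith [this.1], this.2⟩
    · exact ⟨by linarith, by linarith⟩
  · rw [if_pos hi]
    split_ifs with hlt
    · exact sampleAngle_succ_lt (by omega) _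
    · have := sampleAngle_bounds (Nat.succ_pos i) (show 6 * (i + 1) + 2 ≤ ℓ by omega)
      linarith [this.1]
  · rw [show h + 1 + i = h + (i + 1) by ring]
    split_ifs with hlt
    · exact hs (i + 1) (Nat.succ_pos i) (by omega)
    · rw [show i = M by omega]
      exact hψ

theorem mainTheorem4 :
    ∃ L : ℕ, ∀ (k ℓ n j : ℕ) (hk : 4 ≤ k) (hℓ : 4 ≤ ℓ),
      Even k → Even ℓ → L ≤ ℓ → ℓ ≤ k →
      k - ℓ = 12 * n + j → j < 12 →
      stabPoint j ℓ ≤ (k : ℝ) →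
      (ℓ % 6 = 4 → j % 6 = 0 → (k : ℝ) ≠ stabPoint j ℓ) →
      (sideZeros hk hℓ).Finite ∧ sideBound ℓ ≤ (sideZeroCount hk hℓ : ℤ) := by
  obtain ⟨L₁, h₁⟩ := sign_lineDelta_sampleAngle
  obtain ⟨L₂, hL1000, h₂⟩ := exists_corner_sample
  refine ⟨max L₁ L₂, fun k ℓ n j hk hℓ ek eℓ hL hℓk hkℓ _ hsp hne => ?_⟩
  have hL₁ : L₁ ≤ ℓ := (le_max_left _ _).trans hL
  have hL₂ : L₂ ≤ ℓ := (le_max_right _ _).trans hL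
  obtain ⟨p, rfl⟩ := Nat.exists_eq_add_of_le hℓk
  have hpj : p % 6 = j % 6 := by omega
  have ep : Even p := by
    rw [Nat.even_iff] at *
    omega
  obtain ⟨hc0, hc4⟩ := h₂ ℓ p hL₂ eℓ ep
  have hmod : ℓ % 6 = 0 ∨ ℓ % 6 = 2 ∨ ℓ % 6 = 4 := by
    have := Nat.even_iff.1 eℓ
    omega
  rcases hmod with h6 | h6 | h6
  · obtain ⟨s, hs⟩ : ∃ s, ℓ = 6 * (s + 1) := ⟨ℓ / 6 - 1, by omega⟩
    obtain ⟨ψ, hψ0, hψ1, hψ⟩ := hc0 h6 fun hp =>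
      stabPoint_zero_two h6 hp (hpj ▸ hp) (by omega) hsp
    have hsgn : (-1 : ℝ) ^ (3 * (s + 1) + (s + 1)) = 1 := Even.neg_one_pow ⟨2 * (s + 1), by ring⟩
    have := le_sideZeroCount_of_corner (h := 3 * (s + 1)) (M := s) hk hℓ (by omega) ep (by omega)
      (fun m hm0 hm => h₁ _ ℓ m p hL₁ (by omega) hm0 hm ep) hψ0 hψ1
      (by rw [hsgn, one_mul]; exact hψ)
    refine ⟨this.1, ?_⟩
    rw [sideBound_eq (s := s + 1) (i := 0) (by norm_num) (by omega), if_neg (by norm_num)]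
    have := this.2
    push_cast
    omega
  · obtain ⟨s, hs⟩ : ∃ s, ℓ = 6 * (s + 1) + 2 := ⟨ℓ / 6 - 1, by omega⟩
    have := le_sideZeroCount hk hℓ ek eℓ (fun i => sampleAngle ℓ (i + 1)) s (ℓ / 2 + 1)
      (fun i hi => by
        have := sampleAngle_bounds (Nat.succ_pos i) (show 6 * (i + 1) + 2 ≤ ℓ by omega)
        have hnn : (0 : ℝ) ≤ 1 / (10 * ℓ) := by positivity
        exact ⟨by linarith [this.1], this.2⟩)
      (fun i _ => sampleAngle_succ_lt (by omega) _)
      (fun i hi => by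
        rw [show ℓ / 2 + 1 + i = ℓ / 2 + (i + 1) by ring]
        exact h₁ _ ℓ (i + 1) p hL₁ (by omega) (Nat.succ_pos i) (by omega) ep)
    refine ⟨this.1, ?_⟩
    rw [sideBound_eq (s := s + 1) (i := 2) (by norm_num) hs, if_neg (by norm_num)]
    have := this.2
    push_cast
    omega
  · obtain ⟨s, hs⟩ : ∃ s, ℓ = 6 * s + 4 := ⟨ℓ / 6, by omega⟩
    obtain ⟨ψ, hψ0, hψ1, hψ⟩ := hc4 h6
      (fun hp => stabPoint_four_two h6 hp (hpj ▸ hp) hsp)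
      (fun hp => stabPoint_four_zero h6 (hpj ▸ hp) hsp (hne h6 (hpj ▸ hp)))
    have hsgn : (-1 : ℝ) ^ (3 * s + 2 + (s + 1)) = -1 := Odd.neg_one_pow ⟨2 * s + 1, by ring⟩
    have := le_sideZeroCount_of_corner (h := 3 * s + 2) (M := s) hk hℓ (by omega) ep (by omega)
      (fun m hm0 hm => h₁ _ ℓ m p hL₁ (by omega) hm0 hm ep) hψ0 hψ1
      (by rw [hsgn]; linarith)
    refine ⟨this.1, ?_⟩
    rw [sideBound_eq (s := s) (i := 4) (by norm_num) hs, if_pos rfl]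
    exact_mod_cast this.2
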